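/- Let $d\ge 1$, let $\lambda=(\lambda_1\ge\dots\ge\lambda_d\ge 0)$ be a Young diagram with $n=\sum_i\lambda_i$ boxes and at most $d$ rows, and let $f_1,\dots,f_d$ be the standard basis of $\mathbb C^d$. Label the tensor factors of $(\mathbb C^d)^{\otimes n}$ by the boxes of $\lambda$ (read row by row) and let permutations of the boxes act by permuting the factors. Let $p_\lambda=\sum_\sigma\sigma$, over the permutations $\sigma$ preserving each row, let $q_\lambda=\sum_\tau\operatorname{sgn}(\tau)\,\tau$, over the permutations $\tau$ preserving each column, and let $y_\lambda=q_\lambda p_\lambda$. A semistandard Young tableau of shape $\lambda$ with entries in $\{1,\dots,d\}$ (non-decreasing along rows, strictly increasing down columns) is encoded by $\mathbf m=(m_{i,j})_{1\le i<j\le d}$, where $m_{i,j}$ is the number of entries $j$ in row $i$. Let $f_{\mathbf m}$ be the tensor product of the basis vectors $f_j$ whose factor at each box is given by the entry $j$ of the tableau in that box, and put $$|\mathbf m,\lambda\rangle=\frac{y_\lambda f_{\mathbf m}}{\|y_\lambda f_{\mathbf m}\|},\qquad |\mathbf m|=\sum_{i<j}m_{i,j},\qquad |\mathbf m-\mathbf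 l|=\sum_{i<j}|m_{i,j}-l_{i,j}|.$$ Let $(\mathbf m,\lambda)$ and $(\mathbf l,\lambda)$ be two such tableaux of the same shape. (1) If $\sum_{j>i}m_{i,j}-\sum_{j<i}m_{j,i}\neq\sum_{j>i}l_{i,j}-\sum_{j<i}l_{j,i}$ for some $1\le i\le d$, then $\langle\mathbf m,\lambda|\mathbf l,\lambda\rangle=0$. (2) There are constants $C=C(d)>0$ and $K=K(d)\ge 0$ and, for every real $\eta<1/3$, a constant $C'=C'(d,\eta)>0$ such that the following holds for every $\delta>0$. Suppose that the two sides in (1) are equal for every $i$, that $\lambda_i-\lambda_{i+1}>\delta n$ for $1\le i\le d-1$ and $\lambda_d>\delta n$, that $|\mathbf l|\le|\mathbf m|\le n^{\eta}$, and that $Cn^{3\eta-1}/\delta^2<1$. Then $$|\langle\mathbf m,\lambda|\mathbf l,\lambda\rangle|\le R:=(C'n)^{-\eta(|\mathbf m|-|\mathbf l|)/4}\,(C'n)^{(9\eta-2)|\mathbf m-\mathbf l|/12}\,\delta^{(|\mathbf m|-|\mathbf l|)/2-|\mathbf m-\mathbf l|/3}\,\Bigl(1+K\,\frac{n^{-1+3\eta}}{\delta}\Bigr).$$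 (3) With the same constants, for all $\eta<1/3$ and $\delta>0$, the right-hand side $R$ is of order at most $n^{(9\eta-2)|\mathbf m-\mathbf l|/12}$: there is $A=A(d,\eta,\delta)>0$ with $R\le A^{1+|\mathbf m-\mathbf l|}\,n^{(9\eta-2)|\mathbf m-\mathbf l|/12}$ for all $n$, $\lambda$, $\mathbf m$, $\mathbf l$ with $|\mathbf l|\le|\mathbf m|\le n^\eta$. If moreover $\eta<2/9$, then $R\to 0$ as $n\to\infty$, uniformly over all $\lambda$ with $n$ boxes and all $\mathbf m\ne\mathbf l$ with $|\mathbf l|\le|\mathbf m|\le n^\eta$. -/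

import Mathlib

namespace YoungBasis

/-- The boxes of the Young diagram `μ`, as pairs `(row, column)`; rows, columns and (below) the
entries of tableaux and the basis vectors of `ℂ^d` are numbered from `0`. -/
abbrev Box (μ : YoungDiagram) : Type := ↥μ.cells

/-- The Hilbert space `(ℂ^d)^{⊗ n}`, `n = μ.card`, in coordinates with respect to the orthonormal
basis `f_a = ⨂_x f_{a(x)}`. The `n` tensor factors are labelled by the `n` boxes of `μ`
(equivalently, by `1, …, n` read row by row). -/
abbrev TensorPow (d : ℕ) (μ : YoungDiagram) : Type := EuclideanSpace ℂ (Box μ → Fin d)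

/-- The product vector `f_a`. -/
noncomputable def basisVec {d : ℕ} {μ : YoungDiagram} (a : Box μ → Fin d) : TensorPow d μ :=
  EuclideanSpace.single a 1

/-- The operator permuting the tensor factors by `σ`; it sends `f_a` to `f_{a ∘ σ⁻¹}`. -/
noncomputable def permOp (d : ℕ) {μ : YoungDiagram} (σ : Equiv.Perm (Box μ)) :
    TensorPow d μ →ₗ[ℂ] TensorPow d μ where
  toFun ψ := WithLp.toLp 2 fun a => ψ (a ∘ σ)
  map_add' _ _ := rfl
  map_smul' _ _ := rfl

/-- The permutations of the boxes preserving every row. -/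
def rowPerms (μ : YoungDiagram) : Finset (Equiv.Perm (Box μ)) :=
  Finset.univ.filter fun σ => ∀ x, (σ x).1.1 = x.1.1

/-- The permutations of the boxes preserving every column. -/
def colPerms (μ : YoungDiagram) : Finset (Equiv.Perm (Box μ)) :=
  Finset.univ.filter fun τ => ∀ x, (τ x).1.2 = x.1.2

/-- The row symmetriser `p_μ` on the tensor space. -/
noncomputable def rowSym (d : ℕ) (μ : YoungDiagram) : TensorPow d μ →ₗ[ℂ] TensorPow d μ :=
  ∑ σ ∈ rowPerms μ, permOp d σ

/-- The column antisymmetriser `q_μ` on the tensor space. -/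
noncomputable def colAntisym (d : ℕ) (μ : YoungDiagram) : TensorPow d μ →ₗ[ℂ] TensorPow d μ :=
  ∑ τ ∈ colPerms μ, ((Equiv.Perm.sign τ : ℤ) : ℂ) • permOp d τ

/-- The Young symmetriser `y_μ = q_μ p_μ`. -/
noncomputable def youngSym (d : ℕ) (μ : YoungDiagram) : TensorPow d μ →ₗ[ℂ] TensorPow d μ :=
  colAntisym d μ ∘ₗ rowSym d μ

/-- The semistandard Young tableaux of shape `μ` with entries in `{0, …, d - 1}`. -/
def Tableau (d : ℕ) (μ : YoungDiagram) : Type :=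
  {T : SemistandardYoungTableau μ // ∀ x ∈ μ.cells, T x.1 x.2 < d}

/-- The filling of the boxes given by a tableau. -/
def Tableau.word {d : ℕ} {μ : YoungDiagram} (T : Tableau d μ) (x : Box μ) : Fin d :=
  ⟨T.1 x.1.1 x.1.2, T.2 x.1 x.2⟩

/-- `m_{i,j}`: the number of entries `j` in row `i`. -/
def Tableau.mult {d : ℕ} {μ : YoungDiagram} (T : Tableau d μ) (i j : Fin d) : ℕ :=
  (Finset.univ.filter fun x : Box μ => x.1.1 = (i : ℕ) ∧ T.word x = j).card

/-- `|m| = ∑_{i<j} m_{i,j}`. -/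
def Tableau.total {d : ℕ} {μ : YoungDiagram} (T : Tableau d μ) : ℕ :=
  ∑ i : Fin d, ∑ j ∈ Finset.Ioi i, T.mult i j

/-- `|m - l| = ∑_{i<j} |m_{i,j} - l_{i,j}|`. -/
def Tableau.diff {d : ℕ} {μ : YoungDiagram} (T S : Tableau d μ) : ℕ :=
  ∑ i : Fin d, ∑ j ∈ Finset.Ioi i, ((T.mult i j : ℤ) - (S.mult i j : ℤ)).natAbs

/-- `∑_{j>i} m_{i,j} - ∑_{j<i} m_{j,i}`. -/
def Tableau.shift {d : ℕ} {μ : YoungDiagram} (T : Tableau d μ) (i : Fin d) : ℤ :=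
  (∑ j ∈ Finset.Ioi i, (T.mult i j : ℤ)) - ∑ j ∈ Finset.Iio i, (T.mult j i : ℤ)

/-- The normalised vector `|m, μ⟩ = y_μ f_m / ‖y_μ f_m‖`. -/
noncomputable def Tableau.ket {d : ℕ} {μ : YoungDiagram} (T : Tableau d μ) : TensorPow d μ :=
  ((‖youngSym d μ (basisVec T.word)‖⁻¹ : ℝ) : ℂ) • youngSym d μ (basisVec T.word)

/-- The right-hand side of the quasi-orthogonality bound, as a function of the constants `C'`
and `K` (the latter being the constant of the remainder `O(n^{-1+3η}/δ)`), of `η`, `δ`, `n`, and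
of the numbers `M = |m|`, `L = |l|` and `D = |m - l|`. -/
noncomputable def quasiBound (C' K η δ : ℝ) (n M L D : ℕ) : ℝ :=
  (C' * n) ^ (-η * ((M : ℝ) - L) / 4) * (C' * n) ^ ((9 * η - 2) * D / 12)
    * δ ^ (((M : ℝ) - L) / 2 - (D : ℝ) / 3) * (1 + K * ((n : ℝ) ^ (-1 + 3 * η) / δ))

end YoungBasis

/-!
Put `v_m = ∑ f_a` over the words `a` with the same row contents as the tableau `m`. The row
symmetriser sends `f_m` to a positive multiple of `v_m` (`rowSym_basisVec`), so the overlap of two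
kets is `⟨q v_m, q v_l⟩ / (‖q v_m‖ ‖q v_l‖)`. The coefficients of `q v_m` are signed counts of
column permutations (`colCoeff`); they vanish at words with another content than `m`, which gives
the orthogonality (`inner_ket_eq_zero`).

For the quasi-orthogonality both scalar products are reduced to counting.
* `|⟨q v_m, q v_l⟩|` is at most `|Col|` times the number of pairs of column-injective words with the
  row contents of `m` and `l` that have the same entries in each column
  (`abs_sum_colCoeff_mul_le`).
* `‖q v_m‖²` is at least `|Col|` times the number of rigid words (`card_rigidWords_le`). A word
  is rigid if every column is trivial, that is, all entries are the row numbers, or becomes so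
  after changing one entry `j` that exceeds all row numbers in the column
  (`assignedWord_mem_rigidWords`). The number of these words is, up to a factor `2`,
  `Φ(m) = ∏ g_{ij}^{m_{ij}} / m_{ij}!` with `g_{ij} = λ_i - λ_j`
  (`choiceWeight_le_card_moveAssignments`).

It remains to compare the number of pairs of words with `√(Φ(m) Φ(l))`
(`card_pairArrangements_le`). Column by column, a pair of words is a pair of fillings with the same
entries. It is trivial, or both fillings put `j` in row `i` and are trivial otherwise, or it is
complex: it has at least three boxes off the diagonal, with at least one in each filling. The
columns of the second kind account for `√(Φ(m) Φ(l))`, when each off-diagonal box in a complex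
column costs a factor `√(n^η / g_{ij})`. In a complex column one box of each filling has
`g_{ij}` at least the number of columns where the pair of fillings fits, so that the sum over the
positions of the column costs nothing beyond those two boxes; the others cost `√(n^η / (δ n))`.
As the complex columns contain at least `D = |m - l|` boxes off the diagonal, and
`Δ = |m| - |l|` more of them in the first filling than in the second, weighting the boxes by
suitable factors `ρ` and `θ` yields, with `B = δ n^{1-3η}`, an overlap of at most a constant times
both `B^{-D/6}` and `B^{-Δ/2}` (`norm_inner_ket_mul_le`).

Up to the constants, the smaller of these two estimates is better than the claimed bound by the
factor `n^{-η(D-Δ)/4}` (`exponent_le`). Since `∑ (j - i) (m_{ij} - l_{ij}) = 0`, the difference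
`D - Δ` is positive unless the tableaux coincide (`Tableau.total_lt_of_shift_eq`). This factor
absorbs the constant when `η > 1/9`, and the choice of `C'` does so when `η ≤ 1/9`.
-/

namespace YoungBasis

open Finset

/-! ### Pairs of column fillings -/

section Columns

variable {d : ℕ}

/-- The pairs `(i, j)` with `i < j`. -/
def upperPairs (d : ℕ) : Finset (Fin d × Fin d) :=
  univ.filter fun e => e.1 < e.2

/-- A column filling is encoded as a self-map of `Fin d`. Its excess set consists of the pairs
`i < j` such that row `i` contains the entry `j`. -/
def excess (p : Fin d → Fin d) : Finset (Fin d × Fin d) :=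
  (upperPairs d).filter fun e => p e.1 = e.2

/-- Two fillings of a column of length `c`, both extended by `i ↦ i` to the rows `i ≥ c`: each is
injective on the column, has entries at least the row number, and they have the same entries. -/
structure ColPair (c : ℕ) (p : (Fin d → Fin d) × (Fin d → Fin d)) : Prop where
  le_fst : ∀ i, i ≤ p.1 i
  le_snd : ∀ i, i ≤ p.2 i
  fst_eq : ∀ i : Fin d, c ≤ i → p.1 i = i
  snd_eq : ∀ i : Fin d, c ≤ i → p.2 i = i
  inj_fst : ∀ i j : Fin d, (i : ℕ) < c → (j : ℕ) < c → p.1 i = p.1 j → i = j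
  inj_snd : ∀ i j : Fin d, (i : ℕ) < c → (j : ℕ) < c → p.2 i = p.2 j → i = j
  fst_mem : ∀ i : Fin d, (i : ℕ) < c → ∃ j : Fin d, (j : ℕ) < c ∧ p.2 j = p.1 i
  snd_mem : ∀ i : Fin d, (i : ℕ) < c → ∃ j : Fin d, (j : ℕ) < c ∧ p.1 j = p.2 i

lemma ColPair.swap {c : ℕ} {p : (Fin d → Fin d) × (Fin d → Fin d)} (h : ColPair c p) :
    ColPair c p.swap :=
  ⟨h.le_snd, h.le_fst, h.snd_eq, h.fst_eq, h.inj_snd, h.inj_fst, h.snd_mem, h.fst_mem⟩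

/-- The filling with entry `j` in row `i` and entry `k` in every other row `k`. -/
def move (e : Fin d × Fin d) : Fin d → Fin d := Function.update id e.1 e.2

lemma mem_upperPairs {e : Fin d × Fin d} : e ∈ upperPairs d ↔ e.1 < e.2 := by
  simp [upperPairs]

lemma mem_excess {p : Fin d → Fin d} {e : Fin d × Fin d} :
    e ∈ excess p ↔ e.1 < e.2 ∧ p e.1 = e.2 := by
  simp [excess, mem_upperPairs]

lemma move_apply_eq_iff {e f : Fin d × Fin d} (hf : f.1 < f.2) :
    move e f.1 = f.2 ↔ e = f := by
  unfold move
  by_cases h : f.1 = e.1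
  · rw [h, Function.update_self]
    constructor
    · intro h2
      exact Prod.ext h.symm h2
    · rintro rfl
      rfl
  · rw [Function.update_of_ne h]
    constructor
    · intro h2
      exact absurd h2 hf.ne
    · rintro rfl
      exact absurd rfl h

lemma excess_id : excess (id : Fin d → Fin d) = ∅ := by
  ext e
  simp only [mem_excess, id, notMem_empty, iff_false, not_and]
  exact fun h => h.ne

lemma eq_id_of_excess_eq_empty {p : Fin d → Fin d} (hp : ∀ i, i ≤ p i) (h : excess p = ∅) :
    p = id := by
  funext i
  by_contra hi
  have : (i, p i) ∈ excess p := mem_excess.2 ⟨lt_of_le_of_ne (hp i) (Ne.symm hi), rfl⟩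
  simp [h] at this

/-- A nontrivial filling has a pair of excess that crosses the bottom of every column which it can
fill: the one with the largest entry. -/
lemma exists_crossing {p : Fin d → Fin d} (hp : (excess p).Nonempty) :
    ∃ e ∈ excess p, ∀ (c : ℕ) (q : Fin d → Fin d), ColPair c (p, q) →
      (e.1 : ℕ) < c ∧ c ≤ (e.2 : ℕ) := by
  obtain ⟨e, he, hmax⟩ := exists_max_image (excess p) (fun e => e.2) hp
  refine ⟨e, he, fun c q h => ?_⟩
  obtain ⟨he1, he2⟩ := mem_excess.1 he
  have h1 : (e.1 : ℕ) < c := by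
    by_contra hc
    have := h.fst_eq e.1 (not_lt.1 hc)
    simp only at this
    rw [he2] at this
    exact he1.ne this.symm
  refine ⟨h1, ?_⟩
  by_contra hc
  push Not at hc
  -- the entry in row `e.2` can be neither `e.2`, by injectivity, nor larger, by maximality
  rcases eq_or_lt_of_le (h.le_fst e.2) with h2 | h2
  · exact he1.ne (h.inj_fst e.1 e.2 h1 hc (by simp only at h2 ⊢; rw [he2, ← h2]))
  · have := hmax (e.2, p e.2) (mem_excess.2 ⟨h2, rfl⟩)
    exact absurd h2 (not_lt.2 this)

lemma ColPair.excess_nonempty {c : ℕ} {p q : Fin d → Fin d} (h : ColPair c (p, q))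
    (hne : (p, q) ≠ (id, id)) : (excess p).Nonempty := by
  by_contra hp
  rw [not_nonempty_iff_eq_empty] at hp
  have hp' := eq_id_of_excess_eq_empty h.le_fst hp
  simp only at hp'
  have hq : (excess q).Nonempty := by
    by_contra hq
    rw [not_nonempty_iff_eq_empty] at hq
    exact hne (Prod.ext hp' (eq_id_of_excess_eq_empty h.le_snd hq))
  obtain ⟨e, he, hc⟩ := exists_crossing hq
  obtain ⟨h1, h2⟩ := hc c p h.swap
  obtain ⟨j, hj, hj2⟩ := h.snd_mem e.1 h1
  simp only [hp', id] at hj2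
  have : (j : ℕ) = e.2 := by rw [hj2, (mem_excess.1 he).2]
  omega

lemma eq_move_of_excess_eq {p : Fin d → Fin d} (hp : ∀ i, i ≤ p i) {e : Fin d × Fin d}
    (h : excess p = {e}) : p = move e := by
  have he : e ∈ excess p := by simp [h]
  funext i
  unfold move
  by_cases hi : i = e.1
  · subst hi
    rw [Function.update_self]
    exact (mem_excess.1 he).2
  · rw [Function.update_of_ne hi]
    by_contra hne
    have : (i, p i) ∈ excess p := mem_excess.2 ⟨lt_of_le_of_ne (hp i) (Ne.symm hne), rfl⟩
    rw [h, mem_singleton] at this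
    exact hi (by rw [← this])

/-- If neither filling is trivial and they have two excess boxes in all, they coincide. -/
lemma ColPair.eq_move {c : ℕ} {p q : Fin d → Fin d} (h : ColPair c (p, q))
    (hp : (excess p).card = 1) (hq : (excess q).card = 1) :
    ∃ e ∈ upperPairs d, (p, q) = (move e, move e) := by
  obtain ⟨e, he⟩ := card_eq_one.1 hp
  obtain ⟨f, hf⟩ := card_eq_one.1 hq
  have hpe := eq_move_of_excess_eq h.le_fst he
  have hqf := eq_move_of_excess_eq h.le_snd hf
  simp only at hpe hqf
  obtain ⟨e', he', hec⟩ := exists_crossing (p := p) (by simp [he])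
  obtain ⟨f', hf', hfc⟩ := exists_crossing (p := q) (by simp [hf])
  rw [he, mem_singleton] at he'
  rw [hf, mem_singleton] at hf'
  subst he' hf'
  obtain ⟨e1, e2⟩ := hec c q h
  obtain ⟨f1, f2⟩ := hfc c p h.swap
  have hemem : e' ∈ excess p := by simp [he]
  have hfmem : f' ∈ excess q := by simp [hf]
  rw [mem_excess] at hemem hfmem
  have hfst : e'.1 = f'.1 := by
    by_contra hne
    obtain ⟨j, hj, hj2⟩ := h.snd_mem e'.1 e1
    simp only at hj2
    rw [hqf] at hj2
    unfold move at hj2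
    rw [Function.update_of_ne hne, hpe] at hj2
    unfold move at hj2
    by_cases hje : j = e'.1
    · rw [hje, Function.update_self] at hj2
      exact hemem.1.ne hj2.symm
    · rw [Function.update_of_ne hje] at hj2
      exact hje hj2
  have hsnd : e'.2 = f'.2 := by
    obtain ⟨j, hj, hj2⟩ := h.fst_mem e'.1 e1
    simp only at hj2
    rw [hemem.2, hqf] at hj2
    unfold move at hj2
    by_cases hje : j = f'.1
    · rw [hje, Function.update_self] at hj2
      exact hj2.symm
    · rw [Function.update_of_ne hje] at hj2
      simp only [id] at hj2
      rw [hj2] at hj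
      omega
  refine ⟨e', mem_upperPairs.2 hemem.1, ?_⟩
  rw [hpe, hqf, Prod.ext hfst hsnd]

end Columns

/-! ### Counting pairs of column fillings -/

section Arrangements

variable {d : ℕ} {Γ : Type*} [Fintype Γ]

/-- The columns which can be filled by `move e`, `e = (i, j)`: those of length `c` with `i < c ≤ j`
(rows are numbered from `0`). -/
def crossingCols (len : Γ → ℕ) (e : Fin d × Fin d) : Finset Γ :=
  univ.filter fun γ => (e.1 : ℕ) < len γ ∧ len γ ≤ (e.2 : ℕ)

lemma mem_crossingCols {len : Γ → ℕ} {e : Fin d × Fin d} {γ : Γ} :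
    γ ∈ crossingCols len e ↔ (e.1 : ℕ) < len γ ∧ len γ ≤ (e.2 : ℕ) := by
  simp [crossingCols]

/-- The weight `∏_{i<j} g_{ij}^{m_{ij}} / m_{ij}!`, which approximates the number of ways of
choosing disjoint sets of `m_{ij}` columns among `g_{ij}` ones. -/
noncomputable def choiceWeight (g : Fin d × Fin d → ℝ) (m : Fin d × Fin d → ℕ) : ℝ :=
  ∏ e ∈ upperPairs d, g e ^ m e / (m e).factorial

/-- The weight of a pair of column fillings: a factor for each excess box of each filling. -/
noncomputable def pairWeight (α β : Fin d × Fin d → ℝ) (p : (Fin d → Fin d) × (Fin d → Fin d)) :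
    ℝ :=
  (∏ e ∈ excess p.1, α e) * ∏ e ∈ excess p.2, β e

lemma half_choose_bound {N u a : ℕ} {M : ℝ} (hN : 0 < N) (hM : ((u + a : ℕ) : ℝ) ≤ M) :
    √((N : ℝ) ^ u / u.factorial) ≤
      √((N : ℝ) ^ (u + a) / (u + a).factorial) * √(M / N) ^ a := by
  have hN' : (0 : ℝ) < N := by exact_mod_cast hN
  have hM0 : 0 ≤ M := le_trans (Nat.cast_nonneg _) hM
  have hpow : √(M / N) ^ a = √((M / N) ^ a) := by
    rw [eq_comm, Real.sqrt_eq_iff_mul_self_eq (by positivity) (by positivity), ← mul_pow,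
      Real.mul_self_sqrt (by positivity)]
  rw [hpow, ← Real.sqrt_mul (by positivity)]
  apply Real.sqrt_le_sqrt
  have hfac : ((u + a).factorial : ℝ) ≤ u.factorial * M ^ a := by
    have h1 := Nat.factorial_mul_descFactorial (n := u + a) (k := a) (by omega)
    rw [Nat.add_sub_cancel] at h1
    rw [← h1]
    push_cast
    gcongr
    calc ((u + a).descFactorial a : ℝ) ≤ ((u + a : ℕ) : ℝ) ^ a := by
          exact_mod_cast Nat.descFactorial_le_pow _ _
      _ ≤ M ^ a := by gcongr
  have hf : (0 : ℝ) < (u + a).factorial := by positivity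
  have hf' : (0 : ℝ) < u.factorial := by positivity
  rw [div_pow, div_mul_div_comm, div_le_div_iff₀ hf' (by positivity), pow_add]
  calc (N : ℝ) ^ u * ((u + a).factorial * (N : ℝ) ^ a)
      ≤ (N : ℝ) ^ u * ((u.factorial * M ^ a) * (N : ℝ) ^ a) := by gcongr
    _ = _ := by ring

lemma choose_bound {N u a b : ℕ} {M : ℝ} (hN : 0 < N) (ha : ((u + a : ℕ) : ℝ) ≤ M)
    (hb : ((u + b : ℕ) : ℝ) ≤ M) :
    (N.choose u : ℝ) ≤
      √((N : ℝ) ^ (u + a) / (u + a).factorial) * √((N : ℝ) ^ (u + b) / (u + b).factorial) *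
        (√(M / N) ^ a * √(M / N) ^ b) := by
  have h0 : (0 : ℝ) ≤ (N : ℝ) ^ u / u.factorial := by positivity
  calc (N.choose u : ℝ) ≤ (N : ℝ) ^ u / u.factorial := Nat.choose_le_pow_div u N
    _ = √((N : ℝ) ^ u / u.factorial) * √((N : ℝ) ^ u / u.factorial) :=
        (Real.mul_self_sqrt h0).symm
    _ ≤ (√((N : ℝ) ^ (u + a) / (u + a).factorial) * √(M / N) ^ a) *
        (√((N : ℝ) ^ (u + b) / (u + b).factorial) * √(M / N) ^ b) :=
        mul_le_mul (half_choose_bound hN ha) (half_choose_bound hN hb) (Real.sqrt_nonneg _)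
          (by positivity)
    _ = _ := by ring

open Classical in
/-- The ways of filling the columns by pairs of fillings as in `ColPair` such that the first
(second) filling has the entry `j` in row `i` exactly `m_{ij}` (`l_{ij}`) times, `i < j`. -/
noncomputable def pairArrangements (len : Γ → ℕ) (m l : Fin d × Fin d → ℕ) :
    Finset (Γ → (Fin d → Fin d) × (Fin d → Fin d)) :=
  univ.filter fun F => (∀ γ, ColPair (len γ) (F γ)) ∧ ∀ e ∈ upperPairs d,
    (univ.filter fun γ => (F γ).1 e.1 = e.2).card = m e ∧
    (univ.filter fun γ => (F γ).2 e.1 = e.2).card = l e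

open Classical in
/-- The arrangement with every pair `(move e, move e)` replaced by the trivial pair. -/
noncomputable def core (F : Γ → (Fin d → Fin d) × (Fin d → Fin d)) :
    Γ → (Fin d → Fin d) × (Fin d → Fin d) := fun γ =>
  if ∃ e ∈ upperPairs d, F γ = (move e, move e) then (id, id) else F γ

open Classical in
lemma card_eq_card_add_core (F : Γ → (Fin d → Fin d) × (Fin d → Fin d)) {e : Fin d × Fin d}
    (he : e ∈ upperPairs d) (π : (Fin d → Fin d) × (Fin d → Fin d) → Fin d → Fin d)
    (hπ : ∀ p, π (p, p) = p) :
    (univ.filter fun γ => π (F γ) e.1 = e.2).card =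
      (univ.filter fun γ => F γ = (move e, move e)).card +
        (univ.filter fun γ => π (core F γ) e.1 = e.2).card := by
  have he' := mem_upperPairs.1 he
  rw [← card_union_of_disjoint]
  · congr 1
    ext γ
    simp only [mem_filter_univ, mem_union]
    unfold core
    split_ifs with h
    · obtain ⟨f, hf, hF⟩ := h
      rw [hF, hπ, hπ, move_apply_eq_iff he']
      constructor
      · rintro rfl
        exact Or.inl rfl
      · rintro (h | h)
        · have h2 : move f e.1 = e.2 := by
            rw [(Prod.mk.inj h).1]
            exact (move_apply_eq_iff he').2 rfl
          exact (move_apply_eq_iff he').1 h2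
        · exact absurd h he'.ne
    · constructor
      · exact Or.inr
      · rintro (h' | h')
        · exact absurd ⟨e, he, h'⟩ h
        · exact h'
  · rw [disjoint_left]
    intro γ h1 h2
    simp only [mem_filter_univ] at h1 h2
    unfold core at h2
    rw [if_pos ⟨e, he, h1⟩, hπ] at h2
    exact he'.ne h2

open Classical in
lemma prod_pow_card_eq_prod_excess (w : Fin d × Fin d → ℝ) (P : Γ → Fin d → Fin d) :
    ∏ e ∈ upperPairs d, w e ^ (univ.filter fun γ => P γ e.1 = e.2).card =
      ∏ γ, ∏ e ∈ excess (P γ), w e := by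
  simp only [excess, prod_filter]
  rw [prod_comm]
  refine prod_congr rfl fun e _ => ?_
  rw [← prod_filter, prod_const]

open Classical in
/-- The arrangements with a given core are determined by the sets of columns carrying
`(move e, move e)`. -/
lemma card_fiber_le (len : Γ → ℕ) (m l : Fin d × Fin d → ℕ)
    (Z : Γ → (Fin d → Fin d) × (Fin d → Fin d)) (u : Fin d × Fin d → ℕ)
    (hu : ∀ F ∈ pairArrangements len m l, core F = Z → ∀ e ∈ upperPairs d,
      (univ.filter fun γ => F γ = (move e, move e)).card = u e) :
    ((pairArrangements len m l).filter fun F => core F = Z).card ≤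
      ∏ e ∈ upperPairs d, (crossingCols len e).card.choose (u e) := by
  have hcard : ((upperPairs d).pi fun e => powersetCard (u e) (crossingCols len e)).card =
      ∏ e ∈ upperPairs d, (crossingCols len e).card.choose (u e) := by
    rw [card_pi]
    exact prod_congr rfl fun e _ => card_powersetCard _ _
  rw [← hcard]
  refine card_le_card_of_injOn
    (fun F e _ => univ.filter fun γ => F γ = (move e, move e)) ?_ ?_
  · intro F hF
    simp only [coe_filter, Set.mem_ofPred_eq] at hF
    rw [mem_coe, mem_pi]
    intro e he
    rw [mem_powersetCard]
    refine ⟨fun γ hγ => ?_, hu F hF.1 hF.2 e he⟩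
    simp only [mem_filter_univ] at hγ
    have hcol := (mem_filter.1 hF.1).2.1 γ
    rw [hγ] at hcol
    have hmem : ∀ f, f ∈ excess (move e) ↔ f = e := by
      intro f
      rw [mem_excess]
      constructor
      · rintro ⟨h1, h2⟩
        exact ((move_apply_eq_iff h1).1 h2).symm
      · rintro rfl
        exact ⟨mem_upperPairs.1 he, (move_apply_eq_iff (mem_upperPairs.1 he)).2 rfl⟩
    obtain ⟨f, hf, hfc⟩ := exists_crossing (p := move e) ⟨e, (hmem e).2 rfl⟩
    rw [(hmem f).1 hf] at hfc
    simp only [crossingCols, mem_filter_univ]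
    exact hfc _ _ hcol
  · intro F hF F' hF' h
    simp only [coe_filter, Set.mem_ofPred_eq] at hF hF'
    have key : ∀ γ, ∀ e ∈ upperPairs d,
        (F γ = (move e, move e) ↔ F' γ = (move e, move e)) := by
      intro γ e he
      have h2 := congrFun (congrFun h e) he
      have h3 := Finset.ext_iff.1 h2 γ
      simpa using h3
    funext γ
    by_cases hγ : ∃ e ∈ upperPairs d, F γ = (move e, move e)
    · obtain ⟨e, he, hFe⟩ := hγ
      rw [hFe, (key γ e he).1 hFe]
    · have hγ' : ¬ ∃ e ∈ upperPairs d, F' γ = (move e, move e) := by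
        rintro ⟨e, he, hFe⟩
        exact hγ ⟨e, he, (key γ e he).2 hFe⟩
      have h1 := congrFun (hF.2.trans hF'.2.symm) γ
      unfold core at h1
      rwa [if_neg hγ, if_neg hγ'] at h1

open Classical in
lemma card_fiber_le_weight (len : Γ → ℕ) (m l : Fin d × Fin d → ℕ) {M : ℝ}
    (hm : ∀ e ∈ upperPairs d, (m e : ℝ) ≤ M) (hl : ∀ e ∈ upperPairs d, (l e : ℝ) ≤ M)
    (hg : ∀ e ∈ upperPairs d, 0 < (crossingCols len e).card)
    (Z : Γ → (Fin d → Fin d) × (Fin d → Fin d))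
    (hZ : Z ∈ (pairArrangements len m l).image core) :
    (((pairArrangements len m l).filter fun F => core F = Z).card : ℝ) ≤
      √(choiceWeight (fun e => ((crossingCols len e).card : ℝ)) m) *
      √(choiceWeight (fun e => ((crossingCols len e).card : ℝ)) l) *
      ∏ γ, pairWeight (fun e => √(M / (crossingCols len e).card))
        (fun e => √(M / (crossingCols len e).card)) (Z γ) := by
  obtain ⟨F₀, hF₀, rfl⟩ := mem_image.1 hZ
  set a : Fin d × Fin d → ℕ := fun e => (univ.filter fun γ => (core F₀ γ).1 e.1 = e.2).card
  set b : Fin d × Fin d → ℕ := fun e => (univ.filter fun γ => (core F₀ γ).2 e.1 = e.2).card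
  set u : Fin d × Fin d → ℕ := fun e => (univ.filter fun γ => F₀ γ = (move e, move e)).card
  have hcount : ∀ F ∈ pairArrangements len m l, core F = core F₀ → ∀ e ∈ upperPairs d,
      (univ.filter fun γ => F γ = (move e, move e)).card + a e = m e ∧
      (univ.filter fun γ => F γ = (move e, move e)).card + b e = l e := by
    intro F hF hc e he
    have h1 := card_eq_card_add_core F he Prod.fst (fun _ => rfl)
    have h2 := card_eq_card_add_core F he Prod.snd (fun _ => rfl)
    rw [((mem_filter.1 hF).2.2 e he).1, hc] at h1
    rw [((mem_filter.1 hF).2.2 e he).2, hc] at h2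
    exact ⟨h1.symm, h2.symm⟩
  have hu0 := hcount F₀ hF₀ rfl
  have hfib := card_fiber_le len m l (core F₀) u (by
    intro F hF hc e he
    have h1 := (hcount F hF hc e he).1
    have h2 := (hu0 e he).1
    simp only [u]
    omega)
  have hprod : ∏ γ, pairWeight (fun e => √(M / (crossingCols len e).card))
        (fun e => √(M / (crossingCols len e).card)) (core F₀ γ) =
      ∏ e ∈ upperPairs d, (√(M / (crossingCols len e).card) ^ a e *
        √(M / (crossingCols len e).card) ^ b e) := by
    unfold pairWeight
    rw [prod_mul_distrib, prod_mul_distrib,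
      prod_pow_card_eq_prod_excess _ (fun γ => (core F₀ γ).1),
      prod_pow_card_eq_prod_excess _ (fun γ => (core F₀ γ).2)]
  have hsqrt : ∀ k : Fin d × Fin d → ℕ,
      √(choiceWeight (fun e => ((crossingCols len e).card : ℝ)) k) =
      ∏ e ∈ upperPairs d, √(((crossingCols len e).card : ℝ) ^ k e / (k e).factorial) := by
    intro k
    unfold choiceWeight
    rw [Real.sqrt_prod]
    intro e _
    positivity
  rw [hprod, hsqrt, hsqrt, ← prod_mul_distrib, ← prod_mul_distrib]
  calc (((pairArrangements len m l).filter fun F => core F = core F₀).card : ℝ)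
      ≤ ((∏ e ∈ upperPairs d, (crossingCols len e).card.choose (u e) : ℕ) : ℝ) := by
        exact_mod_cast hfib
    _ = ∏ e ∈ upperPairs d, ((crossingCols len e).card.choose (u e) : ℝ) := by push_cast; rfl
    _ ≤ _ := by
        refine prod_le_prod (fun _ _ => Nat.cast_nonneg _) fun e he => ?_
        have h1 := (hu0 e he).1
        have h2 := (hu0 e he).2
        rw [← h1, ← h2]
        refine choose_bound (hg e he) ?_ ?_
        · exact le_trans (le_of_eq (by rw [← h1])) (hm e he)
        · exact le_trans (le_of_eq (by rw [← h2])) (hl e he)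

/-- A pair of fillings of a column of length `c` which is neither trivial nor of the form
`(move e, move e)`. -/
structure ComplexPair (c : ℕ) (p : (Fin d → Fin d) × (Fin d → Fin d)) : Prop where
  colPair : ColPair c p
  ne_id : p ≠ (id, id)
  ne_move : ∀ e ∈ upperPairs d, p ≠ (move e, move e)

/-- Complex pairs have at least three excess boxes, of which each filling contains one. -/
lemma ComplexPair.card_excess {c : ℕ} {p : (Fin d → Fin d) × (Fin d → Fin d)}
    (h : ComplexPair c p) : 1 ≤ (excess p.1).card ∧ 1 ≤ (excess p.2).card ∧
      3 ≤ (excess p.1).card + (excess p.2).card := by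
  obtain ⟨p, q⟩ := p
  have h1 : 1 ≤ (excess p).card := card_pos.2 (h.colPair.excess_nonempty h.ne_id)
  have h2 : 1 ≤ (excess q).card := card_pos.2 (ColPair.excess_nonempty h.colPair.swap (by
    intro h'
    apply h.ne_id
    rw [Prod.mk.injEq] at h' ⊢
    exact h'.symm))
  refine ⟨h1, h2, ?_⟩
  simp only
  by_contra hlt
  obtain ⟨e, he, h3⟩ := h.colPair.eq_move (by omega) (by omega)
  exact h.ne_move e he h3

lemma prod_const_mul_sqrt (S : Finset (Fin d × Fin d)) (t M : ℝ) (g : Fin d × Fin d → ℝ) :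
    ∏ e ∈ S, (t * √(M / g e)) = t ^ S.card * ∏ e ∈ S, √(M / g e) := by
  rw [prod_mul_distrib, prod_const]

lemma prod_sqrt_le {S : Finset (Fin d × Fin d)} {M G : ℝ} {g : Fin d × Fin d → ℝ} (hM : 0 ≤ M)
    (hG : 0 < G) (hg : ∀ e ∈ S, G ≤ g e) {f : Fin d × Fin d} (hf : f ∈ S) :
    ∏ e ∈ S, √(M / g e) ≤ √(M / g f) * √(M / G) ^ (S.card - 1) := by
  rw [← mul_prod_erase S _ hf, ← card_erase_of_mem hf, ← prod_const]
  gcongr with e he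
  exact hg e (mem_of_mem_erase he)

lemma rest_le_one {ρ θ M x : ℝ} {n : ℕ} (hM : 1 ≤ M) (hρ : 1 ≤ ρ) (hθ : 0 ≤ θ) (hx : 0 ≤ x)
    (h : ρ ^ 3 * θ * M * x ≤ 1) (hn : 1 ≤ n) : ρ ^ (n + 2) * θ ^ n * M * x ^ n ≤ 1 := by
  obtain ⟨k, rfl⟩ : ∃ k, n = k + 1 := ⟨n - 1, by omega⟩
  have h0 : ρ * θ * x ≤ ρ ^ 3 * θ * M * x := by
    have h1 : ρ * θ ≤ ρ ^ 3 * θ := by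
      refine mul_le_mul_of_nonneg_right ?_ hθ
      exact le_self_pow₀ hρ (by norm_num)
    have h2 : ρ ^ 3 * θ ≤ ρ ^ 3 * θ * M := le_mul_of_one_le_right (by positivity) hM
    exact mul_le_mul_of_nonneg_right (h1.trans h2) hx
  calc ρ ^ (k + 1 + 2) * θ ^ (k + 1) * M * x ^ (k + 1)
      = (ρ ^ 3 * θ * M * x) * (ρ * θ * x) ^ k := by ring
    _ ≤ 1 * 1 := by
        refine mul_le_mul h (pow_le_one₀ (by positivity) (h0.trans h)) (by positivity) zero_le_one
    _ = 1 := one_mul 1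

lemma mul_pow_div_pow_le {ρ θ : ℝ} {a b : ℕ} (hρ : 0 < ρ) (hθ : 1 ≤ θ) :
    (ρ * θ) ^ (a + 1) * (ρ / θ) ^ (b + 1) ≤ ρ ^ (a + b + 2) * θ ^ (a + b) := by
  have hθ0 : 0 < θ := by linarith
  rw [mul_pow, div_pow, ← mul_div_assoc, div_le_iff₀ (by positivity)]
  have : θ ^ (a + 1) ≤ θ ^ (a + b + (b + 1)) := pow_le_pow_right₀ hθ (by omega)
  calc ρ ^ (a + 1) * θ ^ (a + 1) * ρ ^ (b + 1) = ρ ^ (a + b + 2) * θ ^ (a + 1) := by ring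
    _ ≤ ρ ^ (a + b + 2) * θ ^ (a + b + (b + 1)) := by gcongr
    _ = _ := by ring

lemma mul_weight_le_one {N g g' G M ρ θ P Q : ℝ} {a b : ℕ} (hM : 1 ≤ M) (hρ : 1 ≤ ρ)
    (hθ : 1 ≤ θ) (hG : (ρ ^ 3 * θ) ^ 2 * M ^ 3 ≤ G) (hN : 0 ≤ N) (hg : 0 < g) (hg' : 0 < g')
    (hNg : N ≤ g) (hNg' : N ≤ g') (hQ0 : 0 ≤ Q)
    (hP : P ≤ √(M / g) * √(M / G) ^ a) (hQ : Q ≤ √(M / g') * √(M / G) ^ b) (hab : 1 ≤ a + b) :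
    N * ((ρ * θ) ^ (a + 1) * P * ((ρ / θ) ^ (b + 1) * Q)) ≤ 1 := by
  have hM0 : (0 : ℝ) < M := by linarith
  have hρ0 : (0 : ℝ) < ρ := by linarith
  have hθ0 : (0 : ℝ) < θ := by linarith
  have hG0 : 0 < G := lt_of_lt_of_le (by positivity) hG
  -- one box of each filling pays for the number of columns
  have hfirst : N * (√(M / g) * √(M / g')) ≤ M := by
    have h3 : N ≤ √g * √g' := by
      rw [← Real.sqrt_mul hg.le]
      apply Real.le_sqrt_of_sq_le
      nlinarith
    have h4 : √g * √g' * (√(M / g) * √(M / g')) = M := by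
      rw [Real.sqrt_div hM0.le, Real.sqrt_div hM0.le]
      have := Real.sqrt_pos.2 hg
      have := Real.sqrt_pos.2 hg'
      field_simp
      exact Real.sq_sqrt hM0.le
    calc _ ≤ √g * √g' * (√(M / g) * √(M / g')) := by gcongr
      _ = M := h4
  have hx : ρ ^ 3 * θ * M * √(M / G) ≤ 1 := by
    have h5 : (ρ ^ 3 * θ * M * √(M / G)) ^ 2 ≤ 1 := by
      rw [mul_pow, Real.sq_sqrt (by positivity), ← mul_div_assoc, div_le_one hG0]
      calc _ = (ρ ^ 3 * θ) ^ 2 * M ^ 3 := by ring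
        _ ≤ G := hG
    exact (sq_le_one_iff₀ (by positivity)).1 h5
  calc N * ((ρ * θ) ^ (a + 1) * P * ((ρ / θ) ^ (b + 1) * Q))
      ≤ N * ((ρ * θ) ^ (a + 1) * (√(M / g) * √(M / G) ^ a) *
        ((ρ / θ) ^ (b + 1) * (√(M / g') * √(M / G) ^ b))) := by gcongr
    _ = ((ρ * θ) ^ (a + 1) * (ρ / θ) ^ (b + 1)) * (N * (√(M / g) * √(M / g'))) *
        √(M / G) ^ (a + b) := by ring
    _ ≤ (ρ ^ (a + b + 2) * θ ^ (a + b)) * M * √(M / G) ^ (a + b) := by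
        have := mul_pow_div_pow_le (a := a) (b := b) hρ0 hθ
        gcongr
    _ ≤ 1 := rest_le_one hM hρ hθ0.le (Real.sqrt_nonneg _) hx hab

open Classical in
/-- The number of columns that a complex pair can fill times its weight is at most one. One excess
box of each filling compensates for the number of columns; there are at least as many other excess
boxes as needed to beat the factors `ρ` and `θ`. -/
lemma card_mul_pairWeight_le_one (len : Γ → ℕ) {M G ρ θ : ℝ} (hM : 1 ≤ M) (hρ : 1 ≤ ρ)
    (hθ : 1 ≤ θ) (hG : (ρ ^ 3 * θ) ^ 2 * M ^ 3 ≤ G)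
    (hg : ∀ e ∈ upperPairs d, G ≤ (crossingCols len e).card)
    (p : (Fin d → Fin d) × (Fin d → Fin d)) :
    ((univ.filter fun γ => ComplexPair (len γ) p).card : ℝ) *
      pairWeight (fun e => ρ * θ * √(M / (crossingCols len e).card))
        (fun e => ρ / θ * √(M / (crossingCols len e).card)) p ≤ 1 := by
  rcases (univ.filter fun γ => ComplexPair (len γ) p).eq_empty_or_nonempty with hempty | hne
  · rw [hempty]
    simp
  obtain ⟨γ₀, hγ₀⟩ := hne
  obtain ⟨ha, hb, hab⟩ := (mem_filter.1 hγ₀).2.card_excess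
  have hM0 : (0 : ℝ) < M := by linarith
  have hρ0 : (0 : ℝ) < ρ := by linarith
  have hG0 : 0 < G := lt_of_lt_of_le (by positivity) hG
  have hsub : ∀ q : Fin d → Fin d, excess q ⊆ upperPairs d := fun q => filter_subset _ _
  obtain ⟨e, he, hec⟩ := exists_crossing (card_pos.1 ha)
  obtain ⟨f, hf, hfc⟩ := exists_crossing (card_pos.1 hb)
  have hNe : (univ.filter fun γ => ComplexPair (len γ) p).card ≤ (crossingCols len e).card := by
    refine card_le_card fun γ hγ => ?_
    simp only [mem_filter_univ, crossingCols] at hγ ⊢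
    exact hec _ p.2 hγ.colPair
  have hNf : (univ.filter fun γ => ComplexPair (len γ) p).card ≤ (crossingCols len f).card := by
    refine card_le_card fun γ hγ => ?_
    simp only [mem_filter_univ, crossingCols] at hγ ⊢
    exact hfc _ p.1 hγ.colPair.swap
  have h1 := prod_sqrt_le hM0.le hG0 (fun x hx => hg x (hsub _ hx)) he
  have h2 := prod_sqrt_le hM0.le hG0 (fun x hx => hg x (hsub _ hx)) hf
  unfold pairWeight
  rw [prod_const_mul_sqrt _ (ρ * θ) M (fun e => ((crossingCols len e).card : ℝ)),
    prod_const_mul_sqrt _ (ρ / θ) M (fun e => ((crossingCols len e).card : ℝ))]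
  obtain ⟨a, ha'⟩ : ∃ a, (excess p.1).card = a + 1 := ⟨(excess p.1).card - 1, by omega⟩
  obtain ⟨b, hb'⟩ : ∃ b, (excess p.2).card = b + 1 := ⟨(excess p.2).card - 1, by omega⟩
  rw [ha', Nat.add_sub_cancel] at h1
  rw [hb', Nat.add_sub_cancel] at h2
  rw [ha', hb']
  exact mul_weight_le_one hM hρ hθ hG (Nat.cast_nonneg _)
    (lt_of_lt_of_le hG0 (hg e (hsub _ he))) (lt_of_lt_of_le hG0 (hg f (hsub _ hf)))
    (Nat.cast_le.2 hNe) (Nat.cast_le.2 hNf) (prod_nonneg fun _ _ => Real.sqrt_nonneg _) h1 h2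
    (by omega)

open Classical in
lemma core_mem {len : Γ → ℕ} {m l : Fin d × Fin d → ℕ}
    {F : Γ → (Fin d → Fin d) × (Fin d → Fin d)} (hF : F ∈ pairArrangements len m l) (γ : Γ) :
    core F γ ∈ insert (id, id) (univ.filter fun p => ComplexPair (len γ) p) := by
  rw [mem_insert, mem_filter_univ]
  unfold core
  split_ifs with h
  · exact Or.inl rfl
  · by_cases hid : F γ = (id, id)
    · exact Or.inl hid
    · exact Or.inr ⟨(mem_filter.1 hF).2.1 γ, hid, fun e he h2 => h ⟨e, he, h2⟩⟩

open Classical in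
lemma sum_prod_pairWeight_le (len : Γ → ℕ) (m l : Fin d × Fin d → ℕ) {M G ρ θ : ℝ} (hM : 1 ≤ M)
    (hρ : 1 ≤ ρ) (hθ : 1 ≤ θ) (hG : (ρ ^ 3 * θ) ^ 2 * M ^ 3 ≤ G)
    (hg : ∀ e ∈ upperPairs d, G ≤ (crossingCols len e).card) :
    ∑ Z ∈ (pairArrangements len m l).image core,
      ∏ γ, pairWeight (fun e => ρ * θ * √(M / (crossingCols len e).card))
        (fun e => ρ / θ * √(M / (crossingCols len e).card)) (Z γ) ≤
      Real.exp (Fintype.card ((Fin d → Fin d) × (Fin d → Fin d))) := by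
  set W := pairWeight (fun e : Fin d × Fin d => ρ * θ * √(M / (crossingCols len e).card))
        (fun e => ρ / θ * √(M / (crossingCols len e).card)) with hW
  have hW0 : ∀ p, 0 ≤ W p := by
    intro p
    rw [hW]
    unfold pairWeight
    apply mul_nonneg <;> exact prod_nonneg fun e _ => by positivity
  have hWid : W (id, id) = 1 := by
    rw [hW]
    unfold pairWeight
    simp [excess_id]
  calc ∑ Z ∈ (pairArrangements len m l).image core, ∏ γ, W (Z γ)
      ≤ ∑ Z ∈ Fintype.piFinset (fun γ => insert (id, id)
          (univ.filter fun p => ComplexPair (d := d) (len γ) p)), ∏ γ, W (Z γ) := by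
        apply sum_le_sum_of_subset_of_nonneg
        · intro Z hZ
          obtain ⟨F, hF, rfl⟩ := mem_image.1 hZ
          rw [Fintype.mem_piFinset]
          exact core_mem hF
        · intro Z _ _
          exact prod_nonneg fun γ _ => hW0 _
    _ = ∏ γ, ∑ p ∈ insert (id, id) (univ.filter fun p => ComplexPair (d := d) (len γ) p), W p :=
        (prod_univ_sum _ _).symm
    _ ≤ ∏ γ : Γ, Real.exp (∑ p ∈ univ.filter (fun p => ComplexPair (d := d) (len γ) p), W p) := by
        refine prod_le_prod (fun γ _ => sum_nonneg fun p _ => hW0 p) fun γ _ => ?_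
        rw [sum_insert (by simpa using fun h : ComplexPair (len γ) (id, id) => h.ne_id rfl), hWid,
          add_comm]
        exact Real.add_one_le_exp _
    _ = Real.exp (∑ p, (univ.filter fun γ => ComplexPair (len γ) p).card * W p) := by
        rw [← Real.exp_sum]
        congr 1
        simp only [sum_filter]
        rw [sum_comm]
        refine sum_congr rfl fun p _ => ?_
        rw [← sum_filter, sum_const, nsmul_eq_mul]
    _ ≤ Real.exp (∑ p : (Fin d → Fin d) × (Fin d → Fin d), 1) := by
        gcongr with p
        exact card_mul_pairWeight_le_one len hM hρ hθ hG hg p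
    _ = _ := by simp

open Classical in
/-- The number of arrangements, compared with the geometric mean of the weights of `m` and `l`.
The parameter `ρ` counts the excess boxes in the core, of which there are at least
`D = ∑ |m_{ij} - l_{ij}|`, and `θ` the surplus `Δ = ∑ m_{ij} - ∑ l_{ij}` of the first filling. -/
theorem card_pairArrangements_le (len : Γ → ℕ) (m l : Fin d × Fin d → ℕ) {M G ρ θ : ℝ}
    (hM : 1 ≤ M) (hρ : 1 ≤ ρ) (hθ : 1 ≤ θ) (hG : (ρ ^ 3 * θ) ^ 2 * M ^ 3 ≤ G)
    (hg : ∀ e ∈ upperPairs d, G ≤ (crossingCols len e).card)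
    (hm : ∀ e ∈ upperPairs d, (m e : ℝ) ≤ M) (hl : ∀ e ∈ upperPairs d, (l e : ℝ) ≤ M)
    {D Δ : ℕ} (hD : ∑ e ∈ upperPairs d, ((m e : ℤ) - l e).natAbs = D)
    (hΔ : ∑ e ∈ upperPairs d, m e = ∑ e ∈ upperPairs d, l e + Δ) :
    ((pairArrangements len m l).card : ℝ) * (ρ ^ D * θ ^ Δ) ≤
      √(choiceWeight (fun e => ((crossingCols len e).card : ℝ)) m) *
      √(choiceWeight (fun e => ((crossingCols len e).card : ℝ)) l) *
      Real.exp (Fintype.card ((Fin d → Fin d) × (Fin d → Fin d))) := by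
  have hM0 : (0 : ℝ) < M := by linarith
  have hρ0 : (0 : ℝ) < ρ := by linarith
  have hθ0 : (0 : ℝ) < θ := by linarith
  have hG0 : 0 < G := lt_of_lt_of_le (by positivity) hG
  set S := √(choiceWeight (fun e => ((crossingCols len e).card : ℝ)) m) *
      √(choiceWeight (fun e => ((crossingCols len e).card : ℝ)) l)
  have hS : 0 ≤ S := by positivity
  set w : Fin d × Fin d → ℝ := fun e => √(M / (crossingCols len e).card) with hw
  have hscale : ∀ Z ∈ (pairArrangements len m l).image core,
      (∏ γ, pairWeight w w (Z γ)) * (ρ ^ D * θ ^ Δ) ≤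
        ∏ γ, pairWeight (fun e => ρ * θ * w e) (fun e => ρ / θ * w e) (Z γ) := by
    intro Z hZ
    obtain ⟨F, hF, rfl⟩ := mem_image.1 hZ
    set a : Fin d × Fin d → ℕ := fun e => (univ.filter fun γ => (core F γ).1 e.1 = e.2).card
    set b : Fin d × Fin d → ℕ := fun e => (univ.filter fun γ => (core F γ).2 e.1 = e.2).card
    have hcount : ∀ e ∈ upperPairs d, ∃ u, u + a e = m e ∧ u + b e = l e := by
      intro e he
      have h1 := card_eq_card_add_core F he Prod.fst (fun _ => rfl)
      have h2 := card_eq_card_add_core F he Prod.snd (fun _ => rfl)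
      rw [((mem_filter.1 hF).2.2 e he).1] at h1
      rw [((mem_filter.1 hF).2.2 e he).2] at h2
      exact ⟨_, h1.symm, h2.symm⟩
    have hΔ' : ∑ e ∈ upperPairs d, a e = ∑ e ∈ upperPairs d, b e + Δ := by
      have h3 : ∑ e ∈ upperPairs d, (m e + b e) = ∑ e ∈ upperPairs d, (l e + a e) := by
        refine sum_congr rfl fun e he => ?_
        obtain ⟨u, h1, h2⟩ := hcount e he
        omega
      rw [sum_add_distrib, sum_add_distrib] at h3
      omega
    have hD' : D ≤ ∑ e ∈ upperPairs d, a e + ∑ e ∈ upperPairs d, b e := by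
      rw [← hD, ← sum_add_distrib]
      refine sum_le_sum fun e he => ?_
      obtain ⟨u, h1, h2⟩ := hcount e he
      omega
    have hexp : ∀ α β : ℝ, ∏ γ, pairWeight (fun e => α * w e) (fun e => β * w e) (core F γ) =
        α ^ (∑ e ∈ upperPairs d, a e) * β ^ (∑ e ∈ upperPairs d, b e) *
          ∏ γ, pairWeight w w (core F γ) := by
      intro α β
      unfold pairWeight
      rw [prod_mul_distrib, prod_mul_distrib,
        ← prod_pow_card_eq_prod_excess _ (fun γ => (core F γ).1),
        ← prod_pow_card_eq_prod_excess _ (fun γ => (core F γ).2),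
        ← prod_pow_card_eq_prod_excess _ (fun γ => (core F γ).1),
        ← prod_pow_card_eq_prod_excess _ (fun γ => (core F γ).2)]
      simp only [mul_pow, prod_mul_distrib, prod_pow_eq_pow_sum]
      ring
    rw [hexp, mul_comm]
    have hw0 : 0 ≤ ∏ γ, pairWeight w w (core F γ) := by
      refine prod_nonneg fun γ _ => ?_
      unfold pairWeight
      apply mul_nonneg <;> exact prod_nonneg fun e _ => Real.sqrt_nonneg _
    refine mul_le_mul_of_nonneg_right ?_ hw0
    rw [hΔ'] at hD' ⊢
    set t := ∑ e ∈ upperPairs d, b e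
    calc ρ ^ D * θ ^ Δ ≤ ρ ^ (t + Δ + t) * θ ^ Δ := by gcongr
      _ = (ρ * θ) ^ (t + Δ) * (ρ / θ) ^ t := by
          rw [mul_pow, div_pow]
          field_simp
          ring
  calc ((pairArrangements len m l).card : ℝ) * (ρ ^ D * θ ^ Δ)
      = ∑ Z ∈ (pairArrangements len m l).image core,
          (((pairArrangements len m l).filter fun F => core F = Z).card : ℝ) *
            (ρ ^ D * θ ^ Δ) := by
        rw [← sum_mul, card_eq_sum_card_image core]
        push_cast
        rfl
    _ ≤ ∑ Z ∈ (pairArrangements len m l).image core,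
          S * ∏ γ, pairWeight (fun e => ρ * θ * w e) (fun e => ρ / θ * w e) (Z γ) := by
        refine sum_le_sum fun Z hZ => ?_
        have hg0 : ∀ e ∈ upperPairs d, 0 < (crossingCols len e).card := fun e he => by
          have := lt_of_lt_of_le hG0 (hg e he)
          exact_mod_cast this
        calc _ ≤ (S * ∏ γ, pairWeight w w (Z γ)) * (ρ ^ D * θ ^ Δ) := by
              gcongr
              exact card_fiber_le_weight len m l hm hl hg0 Z hZ
          _ = S * ((∏ γ, pairWeight w w (Z γ)) * (ρ ^ D * θ ^ Δ)) := by ring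
          _ ≤ _ := by
              gcongr
              exact hscale Z hZ
    _ = S * ∑ Z ∈ (pairArrangements len m l).image core,
          ∏ γ, pairWeight (fun e => ρ * θ * w e) (fun e => ρ / θ * w e) (Z γ) := by
        rw [mul_sum]
    _ ≤ _ := by
        gcongr
        exact sum_prod_pairWeight_le len m l hM hρ hθ hG hg

end Arrangements

/-! ### Counting disjoint choices of columns -/

section Simple

variable {d : ℕ} {Γ : Type*} [Fintype Γ]

open Classical in
/-- The assignments of pairs `e ∈ T` to some of the columns, such that `e` is assigned to `m e`
columns, all of which can be filled by `move e`. -/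
noncomputable def moveAssignments (len : Γ → ℕ) (m : Fin d × Fin d → ℕ)
    (T : Finset (Fin d × Fin d)) : Finset (Γ → Option (Fin d × Fin d)) :=
  univ.filter fun f => (∀ γ e, f γ = some e → e ∈ T ∧ γ ∈ crossingCols len e) ∧
    ∀ e ∈ T, (univ.filter fun γ => f γ = some e).card = m e

open Classical in
lemma moveAssignments_some {len : Γ → ℕ} {m : Fin d × Fin d → ℕ} {T : Finset (Fin d × Fin d)}
    {f : Γ → Option (Fin d × Fin d)} (hf : f ∈ moveAssignments len m T) :
    ∀ γ e, f γ = some e → e ∈ T ∧ γ ∈ crossingCols len e :=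
  (mem_filter.1 hf).2.1

open Classical in
lemma moveAssignments_card {len : Γ → ℕ} {m : Fin d × Fin d → ℕ} {T : Finset (Fin d × Fin d)}
    {f : Γ → Option (Fin d × Fin d)} (hf : f ∈ moveAssignments len m T) :
    ∀ e ∈ T, (univ.filter fun γ => f γ = some e).card = m e :=
  (mem_filter.1 hf).2.2

open Classical in
lemma card_support_of_mem_moveAssignments {len : Γ → ℕ} {m : Fin d × Fin d → ℕ}
    {T : Finset (Fin d × Fin d)} {f : Γ → Option (Fin d × Fin d)}
    (hf : f ∈ moveAssignments len m T) :
    (univ.filter fun γ => f γ ≠ none).card = ∑ e ∈ T, m e := by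
  obtain ⟨h1, h2⟩ := (mem_filter.1 hf).2
  have : (univ.filter fun γ => f γ ≠ none) =
      T.biUnion fun e => univ.filter fun γ => f γ = some e := by
    ext γ
    simp only [mem_filter_univ, mem_biUnion]
    constructor
    · intro h
      obtain ⟨e, he⟩ := Option.ne_none_iff_exists'.1 h
      exact ⟨e, (h1 γ e he).1, he⟩
    · rintro ⟨e, _, he⟩
      simp [he]
  rw [this, card_biUnion]
  · exact sum_congr rfl h2
  · intro e _ e' _ hne
    rw [Function.onFun, disjoint_left]
    intro γ hγ hγ'
    simp only [mem_filter_univ] at hγ hγ'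
    rw [hγ] at hγ'
    exact hne (Option.some.inj hγ')

open Classical in
lemma card_moveAssignments_insert (len : Γ → ℕ) (m : Fin d × Fin d → ℕ)
    {T : Finset (Fin d × Fin d)} {e : Fin d × Fin d} (he : e ∉ T) :
    (moveAssignments len m T).card *
      ((crossingCols len e).card - ∑ e ∈ T, m e).choose (m e) ≤
      (moveAssignments len m (insert e T)).card := by
  set B : (Γ → Option (Fin d × Fin d)) → Finset (Finset Γ) := fun f =>
    powersetCard (m e) ((crossingCols len e) \ (univ.filter fun γ => f γ ≠ none)) with hB
  have hcard : (moveAssignments len m T).card *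
      ((crossingCols len e).card - ∑ e ∈ T, m e).choose (m e) ≤
      ((moveAssignments len m T).sigma B).card := by
    rw [card_sigma, ← smul_eq_mul, ← sum_const]
    refine sum_le_sum fun f hf => ?_
    rw [hB, card_powersetCard]
    apply Nat.choose_le_choose
    rw [← card_support_of_mem_moveAssignments hf]
    exact le_card_sdiff _ _
  refine hcard.trans (card_le_card_of_injOn
    (fun x γ => if γ ∈ x.2 then some e else x.1 γ) ?_ ?_)
  · rintro ⟨f, S⟩ hx
    rw [mem_coe, mem_sigma] at hx
    obtain ⟨hf, hS⟩ := hx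
    simp only at hf hS
    rw [hB, mem_powersetCard] at hS
    obtain ⟨h1, h2⟩ := (mem_filter.1 hf).2
    have hSc : ∀ γ ∈ S, γ ∈ crossingCols len e ∧ f γ = none := by
      intro γ hγ
      simpa using hS.1 hγ
    rw [mem_coe]
    simp only [moveAssignments, mem_filter_univ]
    constructor
    · intro γ e' h
      split_ifs at h with hγ
      · rw [← Option.some.inj h]
        exact ⟨mem_insert_self _ _, (hSc γ hγ).1⟩
      · exact ⟨mem_insert_of_mem (h1 γ e' h).1, (h1 γ e' h).2⟩
    · intro e' he'
      rcases eq_or_ne e' e with rfl | hne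
      · rw [← hS.2]
        congr 1
        ext γ
        simp only [mem_filter_univ]
        split_ifs with hγ
        · simp [hγ]
        · simp only [hγ, iff_false]
          exact fun h => he (h1 γ _ h).1
      · rw [← h2 e' (mem_of_mem_insert_of_ne he' hne)]
        congr 1
        ext γ
        simp only [mem_filter_univ]
        split_ifs with hγ
        · rw [(hSc γ hγ).2]
          simp [hne.symm]
        · rfl
  · rintro ⟨f, S⟩ hx ⟨f', S'⟩ hx' h
    rw [mem_coe, mem_sigma] at hx hx'
    simp only at h hx hx'
    have hSc : ∀ γ ∈ S, f γ = none := by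
      intro γ hγ
      have := (mem_powersetCard.1 hx.2).1 hγ
      simp only [mem_sdiff, mem_filter_univ, not_not] at this
      exact this.2
    have hSc' : ∀ γ ∈ S', f' γ = none := by
      intro γ hγ
      have := (mem_powersetCard.1 hx'.2).1 hγ
      simp only [mem_sdiff, mem_filter_univ, not_not] at this
      exact this.2
    have hne : ∀ γ, f γ ≠ some e := fun γ hγ => he ((mem_filter.1 hx.1).2.1 γ e hγ).1
    have hne' : ∀ γ, f' γ ≠ some e := fun γ hγ => he ((mem_filter.1 hx'.1).2.1 γ e hγ).1
    have hS : S = S' := by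
      ext γ
      have h3 := congrFun h γ
      by_cases h1 : γ ∈ S <;> by_cases h2 : γ ∈ S' <;> simp only [h1, h2, if_true, if_false] at h3 ⊢
      · exact absurd h3.symm (hne' γ)
      · exact absurd h3 (hne γ)
    subst hS
    have hff : f = f' := by
      funext γ
      have h3 := congrFun h γ
      by_cases h1 : γ ∈ S
      · rw [hSc γ h1, hSc' γ h1]
      · simpa only [h1, if_false] using h3
    rw [hff]

lemma pow_div_factorial_le_choose {a r n : ℕ} (h : a + r ≤ n) :
    ((a : ℝ)) ^ r / r.factorial ≤ (n.choose r : ℝ) := by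
  rw [div_le_iff₀ (by positivity)]
  have h1 : a ^ r ≤ (n + 1 - r) ^ r := Nat.pow_le_pow_left (by omega) r
  have h2 := h1.trans (Nat.pow_sub_le_descFactorial n r)
  rw [Nat.descFactorial_eq_factorial_mul_choose, mul_comm] at h2
  exact_mod_cast h2

lemma prod_le_card_moveAssignments (len : Γ → ℕ) (m : Fin d × Fin d → ℕ) {N : ℕ}
    (hN : ∑ e ∈ upperPairs d, m e ≤ N) (hg : ∀ e ∈ upperPairs d, N ≤ (crossingCols len e).card)
    {T : Finset (Fin d × Fin d)} (hT : T ⊆ upperPairs d) :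
    ∏ e ∈ T, (((crossingCols len e).card : ℝ) - N) ^ m e / (m e).factorial ≤
      ((moveAssignments len m T).card : ℝ) := by
  classical
  induction T using Finset.induction_on with
  | empty =>
    rw [prod_empty]
    have : (fun _ => none) ∈ moveAssignments len m ∅ := by simp [moveAssignments]
    exact_mod_cast card_pos.2 ⟨_, this⟩
  | insert e T he ih =>
    have heE := hT (mem_insert_self e T)
    rw [prod_insert he]
    have h1 := ih ((subset_insert e T).trans hT)
    have h2 : ∑ x ∈ insert e T, m x ≤ N := (sum_le_sum_of_subset hT).trans hN
    rw [sum_insert he] at h2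
    have h3 := hg e heE
    have h4 := pow_div_factorial_le_choose
      (show ((crossingCols len e).card - N) + m e ≤
        (crossingCols len e).card - ∑ e ∈ T, m e by omega)
    rw [Nat.cast_sub h3] at h4
    calc _ ≤ (((crossingCols len e).card - ∑ e ∈ T, m e).choose (m e) : ℝ) *
          ((moveAssignments len m T).card : ℝ) := by
          refine mul_le_mul h4 h1 (prod_nonneg fun x hx => ?_) (Nat.cast_nonneg _)
          have h5 : (0 : ℝ) ≤ (crossingCols len x).card - N :=
            sub_nonneg.2 (by exact_mod_cast hg x (hT (mem_insert_of_mem hx)))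
          positivity
      _ ≤ _ := by
          rw [mul_comm]
          exact_mod_cast card_moveAssignments_insert len m he

/-- If the squared number of columns to be filled is small compared with the sizes of the sets of
columns from which they are chosen, the disjointness costs at most half of the choices. -/
theorem choiceWeight_le_card_moveAssignments (len : Γ → ℕ) (m : Fin d × Fin d → ℕ) {N : ℕ}
    (hN : ∑ e ∈ upperPairs d, m e = N)
    (hg : ∀ e ∈ upperPairs d, 2 * (N : ℝ) ^ 2 ≤ (crossingCols len e).card)
    (hg0 : ∀ e ∈ upperPairs d, 0 < (crossingCols len e).card) :
    choiceWeight (fun e => ((crossingCols len e).card : ℝ)) m / 2 ≤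
      ((moveAssignments len m (upperPairs d)).card : ℝ) := by
  have hgN : ∀ e ∈ upperPairs d, N ≤ (crossingCols len e).card := by
    intro e he
    have h1 : 2 * N ^ 2 ≤ (crossingCols len e).card := by exact_mod_cast hg e he
    nlinarith
  refine le_trans ?_ (prod_le_card_moveAssignments len m hN.le hgN subset_rfl)
  rcases Nat.eq_zero_or_pos N with h0 | hpos
  · subst h0
    have hc : 0 ≤ choiceWeight (fun e => ((crossingCols len e).card : ℝ)) m :=
      prod_nonneg fun e _ => by positivity
    calc _ ≤ choiceWeight (fun e => ((crossingCols len e).card : ℝ)) m := by linarith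
      _ = _ := by simp [choiceWeight]
  have hN1 : (1 : ℝ) ≤ N := by exact_mod_cast hpos
  have hsplit : ∏ e ∈ upperPairs d, (((crossingCols len e).card : ℝ) - N) ^ m e /
      (m e).factorial = choiceWeight (fun e => ((crossingCols len e).card : ℝ)) m *
        ∏ e ∈ upperPairs d, (1 - N / ((crossingCols len e).card : ℝ)) ^ m e := by
    unfold choiceWeight
    rw [← prod_mul_distrib]
    refine prod_congr rfl fun e he => ?_
    have : (0 : ℝ) < (crossingCols len e).card := by exact_mod_cast hg0 e he
    rw [div_mul_eq_mul_div, ← mul_pow]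
    congr 2
    field_simp
  have hhalf : (1 / 2 : ℝ) ≤
      ∏ e ∈ upperPairs d, (1 - N / ((crossingCols len e).card : ℝ)) ^ m e := by
    calc (1 / 2 : ℝ) = 1 + N * (-(1 / (2 * N))) := by field_simp; norm_num
      _ ≤ (1 + (-(1 / (2 * (N : ℝ))))) ^ N := by
          apply one_add_mul_le_pow
          have : 1 / (2 * (N : ℝ)) ≤ 1 := by
            rw [div_le_one (by positivity)]
            linarith
          linarith
      _ = ∏ e ∈ upperPairs d, (1 + (-(1 / (2 * (N : ℝ))))) ^ m e := by
          rw [prod_pow_eq_pow_sum, hN]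
      _ ≤ _ := by
          have hle : 1 / (2 * (N : ℝ)) ≤ 1 := by
            rw [div_le_one (by positivity)]
            linarith
          refine prod_le_prod (fun e _ => pow_nonneg (by linarith) _) fun e he => ?_
          refine pow_le_pow_left₀ (by linarith) ?_ _
          have hc : (0 : ℝ) < (crossingCols len e).card := by exact_mod_cast hg0 e he
          have : N / ((crossingCols len e).card : ℝ) ≤ 1 / (2 * (N : ℝ)) := by
            rw [div_le_div_iff₀ hc (by positivity)]
            have := hg e he
            nlinarith
          linarith
  rw [hsplit, div_eq_mul_one_div]
  exact mul_le_mul_of_nonneg_left hhalf (prod_nonneg fun e _ => by positivity)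

end Simple

/-! ### Words and their row contents -/

section Words

variable {d : ℕ} {μ : YoungDiagram}

/-- The number of entries `j` in row `i` of a word. -/
def wordMult (a : Box μ → Fin d) (i j : Fin d) : ℕ :=
  (univ.filter fun x : Box μ => x.1.1 = (i : ℕ) ∧ a x = j).card

/-- The words with the same row contents as `T`. -/
def rowWords (T : Tableau d μ) : Finset (Box μ → Fin d) :=
  univ.filter fun a => ∀ i j, wordMult a i j = T.mult i j

lemma mem_rowWords {T : Tableau d μ} {a : Box μ → Fin d} :
    a ∈ rowWords T ↔ ∀ i j, wordMult a i j = T.mult i j := by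
  simp [rowWords]

/-- The entries of a semistandard tableau are at least the row numbers. -/
lemma Tableau.row_le_word (T : Tableau d μ) (x : Box μ) : x.1.1 ≤ (T.word x : ℕ) := by
  have key : ∀ i c : ℕ, (i, c) ∈ μ → i ≤ T.1 i c := by
    intro i
    induction i with
    | zero => exact fun c _ => Nat.zero_le _
    | succ i ih =>
      intro c hc
      have h1 := ih c (μ.up_left_mem (Nat.le_succ i) le_rfl hc)
      have h2 := T.1.col_strict (Nat.lt_succ_self i) hc
      exact lt_of_le_of_lt h1 h2
  exact key x.1.1 x.1.2 x.2

lemma Tableau.row_lt (T : Tableau d μ) (x : Box μ) : x.1.1 < d :=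
  lt_of_le_of_lt (T.row_le_word x) (T.word x).2

lemma row_le_of_mem_rowWords {T : Tableau d μ} {a : Box μ → Fin d} (ha : a ∈ rowWords T)
    (x : Box μ) : x.1.1 ≤ (a x : ℕ) := by
  have h1 := mem_rowWords.1 ha ⟨x.1.1, T.row_lt x⟩ (a x)
  have h2 : 0 < wordMult a ⟨x.1.1, T.row_lt x⟩ (a x) := card_pos.2 ⟨x, by simp⟩
  rw [h1] at h2
  obtain ⟨y, hy⟩ := card_pos.1 h2
  simp only [mem_filter_univ] at hy
  rw [← hy.1, ← hy.2]
  exact T.row_le_word y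

lemma Tableau.mult_eq_zero (T : Tableau d μ) {i j : Fin d} (h : j < i) : T.mult i j = 0 := by
  rw [Tableau.mult, card_eq_zero, filter_eq_empty_iff]
  rintro x - ⟨h1, h2⟩
  have := T.row_le_word x
  rw [h1, h2] at this
  exact absurd h (not_lt.2 this)

lemma sum_wordMult (a : Box μ → Fin d) (i : Fin d) :
    ∑ j, wordMult a i j = (univ.filter fun x : Box μ => x.1.1 = (i : ℕ)).card := by
  rw [card_eq_sum_card_fiberwise (f := a) (t := univ) (by simp)]
  refine sum_congr rfl fun j _ => ?_
  rw [filter_filter]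
  rfl

/-- Row contents only need to be compared off the diagonal. -/
lemma wordMult_eq_of_ne {a b : Box μ → Fin d}
    (h : ∀ i j, i ≠ j → wordMult a i j = wordMult b i j) (i j : Fin d) :
    wordMult a i j = wordMult b i j := by
  rcases eq_or_ne i j with rfl | hij
  · have h1 := (sum_wordMult a i).trans (sum_wordMult b i).symm
    rw [← add_sum_erase _ _ (mem_univ i), ← add_sum_erase _ _ (mem_univ i),
      sum_congr rfl fun j hj => h i j (ne_of_mem_erase hj).symm] at h1
    exact Nat.add_right_cancel h1
  · exact h i j hij

/-- The boxes whose entry differs from the row number. -/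
def offDiag (a : Box μ → Fin d) : Finset (Box μ) :=
  univ.filter fun x => (a x : ℕ) ≠ x.1.1

lemma card_offDiag (a : Box μ → Fin d) (hd : ∀ x : Box μ, x.1.1 < d) :
    (offDiag a).card = ∑ p : Fin d × Fin d, if p.1 = p.2 then 0 else wordMult a p.1 p.2 := by
  rw [card_eq_sum_card_fiberwise (f := fun x => ((⟨x.1.1, hd x⟩ : Fin d), a x)) (t := univ)
    (by simp)]
  refine sum_congr rfl fun p _ => ?_
  rw [offDiag, filter_filter]
  split_ifs with hp
  · rw [card_eq_zero, filter_eq_empty_iff]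
    rintro x - ⟨h1, h2⟩
    obtain ⟨h2, h3⟩ := Prod.mk.inj h2
    apply h1
    rw [h3, ← hp, ← h2]
  · unfold wordMult
    congr 1
    ext x
    simp only [mem_filter_univ, Prod.ext_iff, Fin.ext_iff]
    constructor
    · exact fun h => h.2
    · refine fun h => ⟨?_, h⟩
      rw [h.1, h.2]
      exact fun h' => hp (Fin.ext h'.symm)

/-! ### The vectors `y_μ f_m` in coordinates -/

lemma permOp_apply (σ : Equiv.Perm (Box μ)) (ψ : TensorPow d μ) (a : Box μ → Fin d) :
    permOp d σ ψ a = ψ (a ∘ σ) := rfl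

lemma one_mem_rowPerms : (1 : Equiv.Perm (Box μ)) ∈ rowPerms μ := by simp [rowPerms]

lemma mul_mem_rowPerms {σ τ : Equiv.Perm (Box μ)} (hσ : σ ∈ rowPerms μ) (hτ : τ ∈ rowPerms μ) :
    σ * τ ∈ rowPerms μ := by
  simp only [rowPerms, mem_filter_univ, Equiv.Perm.mul_apply] at *
  intro x
  rw [hσ, hτ]

lemma inv_mem_rowPerms {σ : Equiv.Perm (Box μ)} (hσ : σ ∈ rowPerms μ) : σ⁻¹ ∈ rowPerms μ := by
  simp only [rowPerms, mem_filter_univ] at *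
  intro x
  rw [← hσ (σ⁻¹ x), show σ (σ⁻¹ x) = x from σ.apply_symm_apply x]

lemma one_mem_colPerms : (1 : Equiv.Perm (Box μ)) ∈ colPerms μ := by simp [colPerms]

lemma mul_mem_colPerms {σ τ : Equiv.Perm (Box μ)} (hσ : σ ∈ colPerms μ) (hτ : τ ∈ colPerms μ) :
    σ * τ ∈ colPerms μ := by
  simp only [colPerms, mem_filter_univ, Equiv.Perm.mul_apply] at *
  intro x
  rw [hσ, hτ]

lemma inv_mem_colPerms {σ : Equiv.Perm (Box μ)} (hσ : σ ∈ colPerms μ) : σ⁻¹ ∈ colPerms μ := by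
  simp only [colPerms, mem_filter_univ] at *
  intro x
  rw [← hσ (σ⁻¹ x), show σ (σ⁻¹ x) = x from σ.apply_symm_apply x]

lemma wordMult_comp_of_mem_rowPerms (a : Box μ → Fin d) {σ : Equiv.Perm (Box μ)}
    (hσ : σ ∈ rowPerms μ) (i j : Fin d) : wordMult (a ∘ σ) i j = wordMult a i j := by
  unfold wordMult
  refine card_bij (fun x _ => σ x) ?_ (fun _ _ _ _ h => σ.injective h) ?_
  · intro x hx
    simp only [mem_filter_univ, Function.comp, rowPerms] at hx hσ ⊢
    rw [hσ]
    exact hx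
  · intro y hy
    have hy' : σ (σ⁻¹ y) = y := σ.apply_symm_apply y
    refine ⟨σ⁻¹ y, ?_, hy'⟩
    have := inv_mem_rowPerms hσ
    simp only [mem_filter_univ, Function.comp, rowPerms] at hy this ⊢
    rw [this, hy']
    exact hy

/-- Words with the same row contents differ by a row permutation. -/
lemma exists_rowPerm {T : Tableau d μ} {a : Box μ → Fin d} (ha : a ∈ rowWords T) :
    ∃ σ ∈ rowPerms μ, a ∘ σ = T.word := by
  let f : Box μ → ℕ × Fin d := fun x => (x.1.1, T.word x)
  let g : Box μ → ℕ × Fin d := fun x => (x.1.1, a x)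
  have hcard : ∀ c, Fintype.card {x // f x = c} = Fintype.card {x // g x = c} := by
    rintro ⟨i, j⟩
    rw [Fintype.card_subtype, Fintype.card_subtype]
    by_cases hi : i < d
    · have := mem_rowWords.1 ha ⟨i, hi⟩ j
      simp only [Tableau.mult, wordMult] at this
      simp only [f, g, Prod.mk.injEq]
      exact this.symm
    · have : ∀ (b : Box μ → Fin d) (x : Box μ), (x.1.1, b x) ≠ (i, j) := by
        intro b x h
        rw [Prod.mk.injEq] at h
        exact hi (h.1 ▸ T.row_lt x)
      simp [f, g, this]
  let E := Equiv.ofFiberEquiv fun c => Fintype.equivOfCardEq (hcard c)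
  have hE : ∀ x, g (E x) = f x := Equiv.ofFiberEquiv_map _
  refine ⟨E, ?_, ?_⟩
  · simp only [rowPerms, mem_filter_univ]
    exact fun x => congrArg (fun p : ℕ × Fin d => p.1) (hE x)
  · funext x
    exact congrArg (fun p : ℕ × Fin d => p.2) (hE x)

/-- The sum of the basis vectors of the words with the row contents of `T`. -/
noncomputable def rowVec (T : Tableau d μ) : TensorPow d μ :=
  WithLp.toLp 2 fun a => if a ∈ rowWords T then 1 else 0

/-- The row symmetriser maps `f_m` to a positive multiple of `rowVec`. -/
lemma rowSym_basisVec (T : Tableau d μ) :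
    ∃ s : ℕ, 0 < s ∧ rowSym d μ (basisVec T.word) = (s : ℂ) • rowVec T := by
  classical
  refine ⟨((rowPerms μ).filter fun σ : Equiv.Perm (Box μ) => T.word ∘ σ = T.word).card,
    card_pos.2 ⟨1, mem_filter.2 ⟨one_mem_rowPerms, rfl⟩⟩, ?_⟩
  ext a
  have h1 : rowSym d μ (basisVec T.word) a =
      (((rowPerms μ).filter fun σ : Equiv.Perm (Box μ) => a ∘ σ = T.word).card : ℂ) := by
    simp only [rowSym, LinearMap.sum_apply, WithLp.ofLp_sum, Finset.sum_apply, permOp_apply, basisVec,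
      PiLp.single_apply]
    rw [sum_boole]
  rw [h1, PiLp.smul_apply, rowVec]
  simp only [smul_eq_mul]
  split_ifs with ha
  · obtain ⟨σ₀, hσ₀, h0⟩ := exists_rowPerm ha
    rw [mul_one]
    norm_cast
    refine card_bij' (fun σ _ => σ₀⁻¹ * σ) (fun σ _ => σ₀ * σ) ?_ ?_ ?_ ?_
    · intro σ hσ
      rw [mem_filter] at hσ ⊢
      refine ⟨mul_mem_rowPerms (inv_mem_rowPerms hσ₀) hσ.1, ?_⟩
      rw [← hσ.2]
      nth_rewrite 1 [hσ.2]
      rw [← h0]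
      funext x
      simp
    · intro σ hσ
      rw [mem_filter] at hσ ⊢
      refine ⟨mul_mem_rowPerms hσ₀ hσ.1, ?_⟩
      rw [← hσ.2, ← h0]
      rfl
    · intro σ _
      simp
    · intro σ _
      simp
  · rw [mul_zero, Nat.cast_eq_zero, card_eq_zero, filter_eq_empty_iff]
    intro σ hσ h
    apply ha
    rw [mem_rowWords]
    intro i j
    rw [← wordMult_comp_of_mem_rowPerms a hσ, h]
    rfl

/-- The coefficient of `q_μ (rowVec T)` at a word. -/
def colCoeff (T : Tableau d μ) (w : Box μ → Fin d) : ℤ :=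
  ∑ τ ∈ colPerms μ, if w ∘ τ ∈ rowWords T then (Equiv.Perm.sign τ : ℤ) else 0

lemma colAntisym_rowVec_apply (T : Tableau d μ) (w : Box μ → Fin d) :
    colAntisym d μ (rowVec T) w = (colCoeff T w : ℂ) := by
  simp only [colAntisym, LinearMap.sum_apply, WithLp.ofLp_sum, Finset.sum_apply, LinearMap.smul_apply,
    PiLp.smul_apply, permOp_apply, rowVec, colCoeff, Int.cast_sum, smul_eq_mul]
  refine sum_congr rfl fun τ _ => ?_
  split_ifs <;> simp

lemma inner_colAntisym_rowVec (T S : Tableau d μ) :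
    inner ℂ (colAntisym d μ (rowVec T)) (colAntisym d μ (rowVec S)) =
      ((∑ w, colCoeff T w * colCoeff S w : ℤ) : ℂ) := by
  rw [PiLp.inner_apply]
  push_cast
  refine sum_congr rfl fun w _ => ?_
  rw [colAntisym_rowVec_apply, colAntisym_rowVec_apply]
  simp [mul_comm]

lemma norm_colAntisym_rowVec (T : Tableau d μ) :
    ‖colAntisym d μ (rowVec T)‖ = √((∑ w, colCoeff T w * colCoeff T w : ℤ) : ℝ) := by
  rw [@norm_eq_sqrt_re_inner ℂ, inner_colAntisym_rowVec]
  congr 1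

lemma inner_ket (T S : Tableau d μ) :
    inner ℂ T.ket S.ket = (((∑ w, colCoeff T w * colCoeff S w : ℤ) /
      (√((∑ w, colCoeff T w * colCoeff T w : ℤ) : ℝ) *
        √((∑ w, colCoeff S w * colCoeff S w : ℤ) : ℝ)) : ℝ) : ℂ) := by
  have key : ∀ T : Tableau d μ, T.ket = ((‖colAntisym d μ (rowVec T)‖⁻¹ : ℝ) : ℂ) •
      colAntisym d μ (rowVec T) := by
    intro T
    obtain ⟨s, hs, h⟩ := rowSym_basisVec T
    have h1 : youngSym d μ (basisVec T.word) = (s : ℂ) • colAntisym d μ (rowVec T) := by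
      rw [youngSym, LinearMap.comp_apply, h, map_smul]
    have hs' : (s : ℂ) ≠ 0 := Nat.cast_ne_zero.2 hs.ne'
    rw [Tableau.ket, h1, norm_smul, smul_smul, Complex.norm_natCast]
    congr 1
    push_cast
    rw [mul_inv, mul_right_comm, inv_mul_cancel₀ hs', one_mul]
  rw [key T, key S, inner_smul_left, inner_smul_right, inner_colAntisym_rowVec,
    norm_colAntisym_rowVec, norm_colAntisym_rowVec, Complex.conj_ofReal, div_eq_mul_inv, mul_inv]
  push_cast
  ring

end Words

/-! ### Overlaps as counts of words -/

section Overlaps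

variable {d : ℕ} {μ : YoungDiagram}

/-- No column of the word has a repeated entry. -/
def ColInjective (a : Box μ → Fin d) : Prop :=
  ∀ x y : Box μ, x.1.2 = y.1.2 → a x = a y → x = y

lemma ColInjective.comp {a : Box μ → Fin d} (ha : ColInjective a) {τ : Equiv.Perm (Box μ)}
    (hτ : τ ∈ colPerms μ) : ColInjective (a ∘ τ) := by
  intro x y hxy h
  simp only [colPerms, mem_filter_univ] at hτ
  exact τ.injective (ha _ _ (by rw [hτ, hτ, hxy]) h)

/-- A column-injective word determines the column permutation that is applied to it. -/
lemma ColInjective.perm_unique {a : Box μ → Fin d} (ha : ColInjective a)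
    {σ τ : Equiv.Perm (Box μ)} (hσ : σ ∈ colPerms μ) (hτ : τ ∈ colPerms μ)
    (h : a ∘ σ = a ∘ τ) : σ = τ := by
  simp only [colPerms, mem_filter_univ] at hσ hτ
  ext1 x
  exact ha _ _ (by rw [hσ, hτ]) (congrFun h x)

lemma colCoeff_eq_zero (T : Tableau d μ) {w : Box μ → Fin d} (hw : ¬ ColInjective w) :
    colCoeff T w = 0 := by
  unfold ColInjective at hw
  push Not at hw
  obtain ⟨x, y, hxy, h, hne⟩ := hw
  have hs : Equiv.swap x y ∈ colPerms μ := by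
    simp only [colPerms, mem_filter_univ]
    intro z
    rw [Equiv.swap_apply_def]
    split_ifs with h1 h2
    · rw [h1, hxy]
    · rw [h2, hxy]
    · rfl
  have hws : w ∘ Equiv.swap x y = w := by
    funext z
    simp only [Function.comp, Equiv.swap_apply_def]
    split_ifs with h1 h2
    · rw [h1, h]
    · rw [h2, h]
    · rfl
  have key : colCoeff T w = -colCoeff T w := by
    unfold colCoeff
    rw [← sum_neg_distrib]
    refine sum_bij (fun τ _ => Equiv.swap x y * τ) (fun τ hτ => mul_mem_colPerms hs hτ)
      (fun _ _ _ _ h => mul_left_cancel h)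
      (fun τ hτ => ⟨Equiv.swap x y * τ, mul_mem_colPerms hs hτ, by
        rw [← mul_assoc, Equiv.swap_mul_self, one_mul]⟩) ?_
    intro τ _
    rw [Equiv.Perm.coe_mul, ← Function.comp_assoc, hws, map_mul, Equiv.Perm.sign_swap hne]
    split_ifs <;> simp
  omega

open Classical in
/-- The pairs of column-injective words with the row contents of `T` and `S` that differ by a
column permutation. -/
noncomputable def wordPairs (T S : Tableau d μ) : Finset ((Box μ → Fin d) × (Box μ → Fin d)) :=
  univ.filter fun p => p.1 ∈ rowWords T ∧ p.2 ∈ rowWords S ∧ ColInjective p.1 ∧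
    ∃ ρ ∈ colPerms μ, p.2 = p.1 ∘ ρ

lemma abs_colCoeff_le (T : Tableau d μ) (w : Box μ → Fin d) :
    |colCoeff T w| ≤ (((colPerms μ).filter fun τ : Equiv.Perm (Box μ) =>
      w ∘ τ ∈ rowWords T).card : ℤ) := by
  unfold colCoeff
  refine (abs_sum_le_sum_abs _ _).trans ?_
  rw [card_filter]
  push_cast
  refine sum_le_sum fun τ _ => ?_
  split_ifs
  · rcases Int.units_eq_one_or (Equiv.Perm.sign τ) with h | h <;> simp [h]
  · simp

lemma abs_sum_colCoeff_mul_le (T S : Tableau d μ) :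
    |∑ w, colCoeff T w * colCoeff S w| ≤ ((colPerms μ).card * (wordPairs T S).card : ℕ) := by
  classical
  set A : Tableau d μ → (Box μ → Fin d) → Finset (Equiv.Perm (Box μ)) := fun T w =>
    (colPerms μ).filter fun τ : Equiv.Perm (Box μ) => w ∘ τ ∈ rowWords T with hA
  set W : Finset (Box μ → Fin d) := univ.filter ColInjective with hW
  have h1 : |∑ w, colCoeff T w * colCoeff S w| ≤ ((∑ w ∈ W, (A T w ×ˢ A S w).card : ℕ) : ℤ) := by
    refine (abs_sum_le_sum_abs _ _).trans ?_
    rw [hW, sum_filter]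
    push_cast
    refine sum_le_sum fun w _ => ?_
    split_ifs with hw
    · rw [abs_mul, card_product]
      push_cast
      exact mul_le_mul (abs_colCoeff_le T w) (abs_colCoeff_le S w) (abs_nonneg _)
        (Nat.cast_nonneg _)
    · rw [colCoeff_eq_zero T hw]
      simp
  refine h1.trans (Nat.cast_le.2 ?_)
  rw [← card_sigma, ← card_product]
  refine card_le_card_of_injOn (fun x => (x.2.1, (x.1 ∘ x.2.1, x.1 ∘ x.2.2))) ?_ ?_
  · rintro ⟨w, σ, τ⟩ hx
    simp only [coe_sigma, hA, hW, Set.mem_sigma_iff, mem_coe, mem_product, mem_filter] at hx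
    obtain ⟨hw, ⟨hσ, hσ2⟩, hτ, hτ2⟩ := hx
    rw [mem_coe, mem_product]
    refine ⟨hσ, ?_⟩
    simp only [wordPairs, mem_filter_univ]
    refine ⟨hσ2, hτ2, hw.2.comp hσ, σ⁻¹ * τ, mul_mem_colPerms (inv_mem_colPerms hσ) hτ, ?_⟩
    rw [Function.comp_assoc, ← Equiv.Perm.coe_mul, mul_inv_cancel_left]
  · rintro ⟨w, σ, τ⟩ hx ⟨w', σ', τ'⟩ hx' h
    simp only [coe_sigma, hA, hW, Set.mem_sigma_iff, mem_coe, mem_product, mem_filter] at hx hx'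
    simp only [Prod.mk.injEq] at h
    obtain ⟨rfl, h2, h3⟩ := h
    have hww : w = w' := by
      funext x
      have := congrFun h2 (σ⁻¹ x)
      simp only [Function.comp, show σ (σ⁻¹ x) = x from σ.apply_symm_apply x] at this
      exact this
    subst hww
    have := hx.1.2.perm_unique hx.2.2.1 hx'.2.2.1 h3
    rw [this]

open Classical in
/-- The words with the row contents of `T` to which no other column permutation than `1` can be
applied without changing the row contents. -/
noncomputable def rigidWords (T : Tableau d μ) : Finset (Box μ → Fin d) :=
  (rowWords T).filter fun a => ∀ τ ∈ colPerms μ, a ∘ τ ∈ rowWords T → τ = 1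

lemma colCoeff_comp_rigid {T : Tableau d μ} {a : Box μ → Fin d} (ha : a ∈ rigidWords T)
    {τ : Equiv.Perm (Box μ)} (hτ : τ ∈ colPerms μ) :
    colCoeff T (a ∘ τ) * colCoeff T (a ∘ τ) = 1 := by
  obtain ⟨ha1, ha2⟩ := mem_filter.1 ha
  have h : colCoeff T (a ∘ τ) = (Equiv.Perm.sign τ⁻¹ : ℤ) := by
    unfold colCoeff
    rw [sum_eq_single τ⁻¹]
    · rw [if_pos]
      rw [Function.comp_assoc, ← Equiv.Perm.coe_mul, mul_inv_cancel]
      exact ha1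
    · intro σ hσ hne
      rw [if_neg]
      intro h
      rw [Function.comp_assoc, ← Equiv.Perm.coe_mul] at h
      exact hne (eq_inv_of_mul_eq_one_right (ha2 _ (mul_mem_colPerms hτ hσ) h))
    · exact fun h => absurd (inv_mem_colPerms hτ) h
  rw [h]
  rcases Int.units_eq_one_or (Equiv.Perm.sign τ⁻¹) with h | h <;> simp [h]

lemma card_rigidWords_le (T : Tableau d μ) :
    (((colPerms μ).card * (rigidWords T).card : ℕ) : ℤ) ≤ ∑ w, colCoeff T w * colCoeff T w := by
  classical
  set I := (colPerms μ ×ˢ rigidWords T).image fun p => p.2 ∘ p.1 with hI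
  have hcard : I.card = (colPerms μ).card * (rigidWords T).card := by
    rw [hI, card_image_of_injOn, card_product]
    rintro ⟨σ, a⟩ hx ⟨τ, b⟩ hy h
    rw [mem_coe, mem_product] at hx hy
    simp only at hx hy h
    have h1 : a ∘ ⇑(σ * τ⁻¹) = b := by
      rw [Equiv.Perm.coe_mul, ← Function.comp_assoc, h, Function.comp_assoc, ← Equiv.Perm.coe_mul,
        mul_inv_cancel]
      rfl
    have h2 := (mem_filter.1 hx.2).2 _ (mul_mem_colPerms hx.1 (inv_mem_colPerms hy.1))
      (by rw [h1]; exact (mem_filter.1 hy.2).1)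
    have h3 : σ = τ := mul_inv_eq_one.1 h2
    rw [h2] at h1
    exact Prod.ext h3 h1
  calc (((colPerms μ).card * (rigidWords T).card : ℕ) : ℤ) = ∑ w ∈ I, 1 := by
        rw [← hcard]
        simp
    _ = ∑ w ∈ I, colCoeff T w * colCoeff T w := by
        refine sum_congr rfl fun w hw => ?_
        obtain ⟨⟨σ, a⟩, hx, rfl⟩ := mem_image.1 hw
        rw [mem_product] at hx
        exact (colCoeff_comp_rigid hx.2 hx.1).symm
    _ ≤ _ := sum_le_sum_of_subset_of_nonneg (subset_univ _) fun w _ _ => mul_self_nonneg _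

lemma norm_inner_ket_le (T S : Tableau d μ) (hT : 0 < (rigidWords T).card)
    (hS : 0 < (rigidWords S).card) :
    ‖inner ℂ T.ket S.ket‖ ≤ (wordPairs T S).card /
      (√((rigidWords T).card) * √((rigidWords S).card)) := by
  have hc : (0 : ℝ) < (colPerms μ).card := by
    exact_mod_cast card_pos.2 ⟨1, one_mem_colPerms⟩
  have hT' : (0 : ℝ) < (rigidWords T).card := by exact_mod_cast hT
  have hS' : (0 : ℝ) < (rigidWords S).card := by exact_mod_cast hS
  have h1 : |((∑ w, colCoeff T w * colCoeff S w : ℤ) : ℝ)| ≤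
      (colPerms μ).card * (wordPairs T S).card := by
    exact_mod_cast abs_sum_colCoeff_mul_le T S
  have h2 : ∀ T : Tableau d μ, √((colPerms μ).card : ℝ) * √((rigidWords T).card : ℝ) ≤
      √((∑ w, colCoeff T w * colCoeff T w : ℤ) : ℝ) := by
    intro T
    rw [← Real.sqrt_mul hc.le]
    apply Real.sqrt_le_sqrt
    exact_mod_cast card_rigidWords_le T
  rw [inner_ket, Complex.norm_real, Real.norm_eq_abs, abs_div,
    abs_of_nonneg (by positivity : (0 : ℝ) ≤ _ * √_)]
  have hcs := Real.sqrt_pos.2 hc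
  have hTs := Real.sqrt_pos.2 hT'
  have hSs := Real.sqrt_pos.2 hS'
  calc _ ≤ ((colPerms μ).card * (wordPairs T S).card : ℝ) /
        ((√((colPerms μ).card : ℝ) * √((rigidWords T).card : ℝ)) *
          (√((colPerms μ).card : ℝ) * √((rigidWords S).card : ℝ))) := by
        refine div_le_div₀ (by positivity) h1 (by positivity) ?_
        exact mul_le_mul (h2 T) (h2 S) (by positivity) (Real.sqrt_nonneg _)
    _ = _ := by
        have : ((colPerms μ).card : ℝ) = √((colPerms μ).card : ℝ) * √((colPerms μ).card : ℝ) :=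
          (Real.mul_self_sqrt hc.le).symm
        rw [mul_mul_mul_comm, ← this, mul_div_mul_left _ _ hc.ne']

/-! ### Weights and orthogonality -/

/-- The shift in row `j` is the length of the row minus the number of entries `j`. -/
lemma Tableau.shift_eq (T : Tableau d μ) (j : Fin d) :
    T.shift j = ((univ.filter fun x : Box μ => x.1.1 = (j : ℕ)).card : ℤ) -
      (univ.filter fun x : Box μ => T.word x = j).card := by
  have h1 : ((univ.filter fun x : Box μ => x.1.1 = (j : ℕ)).card : ℤ) =
      T.mult j j + ∑ k ∈ Ioi j, (T.mult j k : ℤ) := by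
    rw [← sum_wordMult T.word j]
    push_cast
    rw [← add_sum_erase _ _ (mem_univ j)]
    congr 1
    refine (sum_subset ?_ ?_).symm
    · intro k hk
      rw [mem_erase]
      exact ⟨(mem_Ioi.1 hk).ne', mem_univ _⟩
    · intro k hk hk'
      have hkj : k < j := lt_of_le_of_ne (not_lt.1 fun h => hk' (mem_Ioi.2 h)) (ne_of_mem_erase hk)
      exact_mod_cast T.mult_eq_zero hkj
  have h2 : ((univ.filter fun x : Box μ => T.word x = j).card : ℤ) =
      T.mult j j + ∑ k ∈ Iio j, (T.mult k j : ℤ) := by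
    have h3 : (univ.filter fun x : Box μ => T.word x = j).card = ∑ k, T.mult k j := by
      rw [card_eq_sum_card_fiberwise (f := fun x : Box μ => (⟨x.1.1, T.row_lt x⟩ : Fin d))
        (t := univ) (by simp)]
      refine sum_congr rfl fun k _ => ?_
      rw [filter_filter, Tableau.mult]
      congr 1
      ext x
      simp only [mem_filter_univ, Fin.ext_iff]
      exact and_comm
    rw [h3]
    push_cast
    rw [← add_sum_erase _ _ (mem_univ j)]
    congr 1
    refine (sum_subset ?_ ?_).symm
    · intro k hk
      rw [mem_erase]
      exact ⟨(mem_Iio.1 hk).ne, mem_univ _⟩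
    · intro k hk hk'
      have hkj : j < k :=
        lt_of_le_of_ne (not_lt.1 fun h => hk' (mem_Iio.2 h)) (ne_of_mem_erase hk).symm
      exact_mod_cast T.mult_eq_zero hkj
  rw [h1, h2, Tableau.shift]
  ring

lemma card_filter_comp_perm (a : Box μ → Fin d) (σ : Equiv.Perm (Box μ)) (j : Fin d) :
    (univ.filter fun x => (a ∘ σ) x = j).card = (univ.filter fun x => a x = j).card := by
  refine card_bij (fun x _ => σ x) (by simp) (fun _ _ _ _ h => σ.injective h) ?_
  intro y hy
  exact ⟨σ.symm y, by simpa using hy, σ.apply_symm_apply y⟩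

/-- The words occurring in `q_μ (rowVec T)` have as many entries `j` as `T`. -/
lemma card_filter_eq_of_colCoeff_ne_zero {T : Tableau d μ} {w : Box μ → Fin d}
    (h : colCoeff T w ≠ 0) (j : Fin d) :
    (univ.filter fun x => w x = j).card = (univ.filter fun x => T.word x = j).card := by
  obtain ⟨τ, _, hτ⟩ := exists_ne_zero_of_sum_ne_zero h
  have hτ' : w ∘ τ ∈ rowWords T := by
    by_contra h'
    exact hτ (if_neg h')
  obtain ⟨σ, _, hσ⟩ := exists_rowPerm hτ'
  rw [← hσ, card_filter_comp_perm, card_filter_comp_perm]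

theorem inner_ket_eq_zero (T S : Tableau d μ) {i : Fin d} (h : T.shift i ≠ S.shift i) :
    inner ℂ T.ket S.ket = 0 := by
  rw [inner_ket]
  have : ∑ w, colCoeff T w * colCoeff S w = 0 := by
    refine sum_eq_zero fun w _ => ?_
    by_contra hne
    apply h
    rw [T.shift_eq, S.shift_eq,
      ← card_filter_eq_of_colCoeff_ne_zero (left_ne_zero_of_mul hne),
      ← card_filter_eq_of_colCoeff_ne_zero (right_ne_zero_of_mul hne)]
  rw [this]
  simp

end Overlaps

/-! ### From words to column fillings -/

section Fillings

variable {d : ℕ} {μ : YoungDiagram}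

/-- The length of a column of the diagram; the columns are indexed by `Fin (μ.rowLen 0)`. -/
def colLength (μ : YoungDiagram) (γ : Fin (μ.rowLen 0)) : ℕ := μ.colLen γ

lemma col_lt (x : Box μ) : x.1.2 < μ.rowLen 0 :=
  YoungDiagram.mem_iff_lt_rowLen.1 (μ.up_left_mem (Nat.zero_le x.1.1) le_rfl x.2)

/-- The column of a box. -/
def boxCol (x : Box μ) : Fin (μ.rowLen 0) := ⟨x.1.2, col_lt x⟩

lemma mem_cells_iff_lt_colLength {γ : Fin (μ.rowLen 0)} {i : ℕ} :
    (i, (γ : ℕ)) ∈ μ.cells ↔ i < colLength μ γ :=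
  YoungDiagram.mem_iff_lt_colLen

lemma row_lt_colLength (x : Box μ) : x.1.1 < colLength μ (boxCol x) :=
  mem_cells_iff_lt_colLength.1 x.2

lemma card_crossingCols (e : Fin d × Fin d) :
    (crossingCols (colLength μ) e).card = μ.rowLen e.1 - μ.rowLen e.2 := by
  rw [← Nat.card_Ico]
  refine card_bij (fun γ _ => (γ : ℕ)) ?_ (fun _ _ _ _ h => Fin.ext h) ?_
  · intro γ hγ
    simp only [mem_crossingCols, colLength] at hγ
    rw [mem_Ico]
    constructor
    · by_contra h
      have := YoungDiagram.mem_iff_lt_colLen.1 (YoungDiagram.mem_iff_lt_rowLen.2 (not_le.1 h))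
      omega
    · exact YoungDiagram.mem_iff_lt_rowLen.1 (YoungDiagram.mem_iff_lt_colLen.2 hγ.1)
  · intro c hc
    rw [mem_Ico] at hc
    have h1 : ((e.1 : ℕ), c) ∈ μ := YoungDiagram.mem_iff_lt_rowLen.2 hc.2
    have h0 : c < μ.rowLen 0 := lt_of_lt_of_le hc.2 (μ.rowLen_anti _ _ (Nat.zero_le _))
    refine ⟨⟨c, h0⟩, ?_, rfl⟩
    simp only [mem_crossingCols, colLength]
    refine ⟨YoungDiagram.mem_iff_lt_colLen.1 h1, ?_⟩
    by_contra h
    have := YoungDiagram.mem_iff_lt_rowLen.1 (YoungDiagram.mem_iff_lt_colLen.2 (not_le.1 h))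
    omega

/-- The columns of a word, extended by the row number below the diagram. -/
def colFill (a : Box μ → Fin d) (γ : Fin (μ.rowLen 0)) (i : Fin d) : Fin d :=
  if h : ((i : ℕ), (γ : ℕ)) ∈ μ.cells then a ⟨_, h⟩ else i

lemma colFill_boxCol (a : Box μ → Fin d) (x : Box μ) (hx : x.1.1 < d) :
    colFill a (boxCol x) ⟨x.1.1, hx⟩ = a x := by
  unfold colFill
  rw [dif_pos]
  rfl

lemma exists_box_of_lt {γ : Fin (μ.rowLen 0)} {i : Fin d} (h : (i : ℕ) < colLength μ γ) :
    ∃ x : Box μ, x.1.1 = i ∧ boxCol x = γ ∧ ∀ a : Box μ → Fin d, colFill a γ i = a x := by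
  have h' := mem_cells_iff_lt_colLength.2 h
  refine ⟨⟨_, h'⟩, rfl, rfl, fun a => ?_⟩
  unfold colFill
  rw [dif_pos h']

lemma colFill_of_le (a : Box μ → Fin d) {γ : Fin (μ.rowLen 0)} {i : Fin d}
    (h : colLength μ γ ≤ i) : colFill a γ i = i := by
  unfold colFill
  rw [dif_neg]
  rw [mem_cells_iff_lt_colLength]
  omega

lemma card_colFill (a : Box μ → Fin d) {i j : Fin d} (hij : i ≠ j) :
    (univ.filter fun γ => colFill a γ i = j).card = wordMult a i j := by
  symm
  refine card_bij (fun x _ => boxCol x) ?_ ?_ ?_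
  · intro x hx
    simp only [mem_filter_univ] at hx ⊢
    have hi : (⟨x.1.1, hx.1 ▸ i.2⟩ : Fin d) = i := Fin.ext hx.1
    have := colFill_boxCol a x (hx.1 ▸ i.2)
    rw [hi] at this
    rw [this, hx.2]
  · intro x hx y hy h
    simp only [mem_filter_univ] at hx hy
    exact Subtype.ext (Prod.ext (hx.1.trans hy.1.symm) (congrArg Fin.val h))
  · intro γ hγ
    simp only [mem_filter_univ] at hγ
    have hlt : (i : ℕ) < colLength μ γ := by
      by_contra h
      exact hij ((colFill_of_le a (not_lt.1 h)).symm.trans hγ)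
    obtain ⟨x, hx1, hx2, hx3⟩ := exists_box_of_lt hlt
    refine ⟨x, ?_, hx2⟩
    simp only [mem_filter_univ]
    exact ⟨hx1, by rw [← hx3 a, hγ]⟩

lemma colPair_colFill {T S : Tableau d μ} {p : (Box μ → Fin d) × (Box μ → Fin d)}
    (hp : p ∈ wordPairs T S) (γ : Fin (μ.rowLen 0)) :
    ColPair (colLength μ γ) (colFill p.1 γ, colFill p.2 γ) := by
  simp only [wordPairs, mem_filter_univ] at hp
  obtain ⟨ha, hb, hinj, ρ, hρ, hab⟩ := hp
  have hbinj : ColInjective p.2 := hab ▸ hinj.comp hρ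
  have hle : ∀ (T : Tableau d μ) (a : Box μ → Fin d), a ∈ rowWords T → ∀ i, i ≤ colFill a γ i := by
    intro T a ha i
    rcases lt_or_ge (i : ℕ) (colLength μ γ) with h | h
    · obtain ⟨x, hx1, _, hx3⟩ := exists_box_of_lt h
      rw [hx3, Fin.le_def, ← hx1]
      exact row_le_of_mem_rowWords ha x
    · rw [colFill_of_le a h]
  have hinj' : ∀ a : Box μ → Fin d, ColInjective a → ∀ i j : Fin d, (i : ℕ) < colLength μ γ →
      (j : ℕ) < colLength μ γ → colFill a γ i = colFill a γ j → i = j := by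
    intro a ha i j hi hj h
    obtain ⟨x, hx1, hx2, hx3⟩ := exists_box_of_lt hi
    obtain ⟨y, hy1, hy2, hy3⟩ := exists_box_of_lt hj
    rw [hx3, hy3] at h
    have hxy := ha x y (congrArg Fin.val (hx2.trans hy2.symm)) h
    apply Fin.ext
    rw [← hx1, ← hy1, hxy]
  have hmem : ∀ (a b : Box μ → Fin d) (ρ : Equiv.Perm (Box μ)), ρ ∈ colPerms μ → b = a ∘ ρ →
      ∀ i : Fin d, (i : ℕ) < colLength μ γ →
        ∃ j : Fin d, (j : ℕ) < colLength μ γ ∧ colFill a γ j = colFill b γ i := by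
    intro a b ρ hρ hab i hi
    obtain ⟨x, hx1, hx2, hx3⟩ := exists_box_of_lt hi
    simp only [colPerms, mem_filter_univ] at hρ
    have hcol : boxCol (ρ x) = γ := by
      rw [← hx2]
      exact Fin.ext (hρ x)
    have hrow := row_lt_colLength (ρ x)
    rw [hcol] at hrow
    refine ⟨⟨(ρ x).1.1, T.row_lt _⟩, hrow, ?_⟩
    rw [hx3 b, hab, ← hcol, colFill_boxCol]
    rfl
  refine ⟨hle T _ ha, hle S _ hb, fun i h => colFill_of_le _ h, fun i h => colFill_of_le _ h,
    hinj' _ hinj, hinj' _ hbinj, ?_, hmem p.1 p.2 ρ hρ hab⟩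
  refine hmem p.2 p.1 ρ⁻¹ (inv_mem_colPerms hρ) ?_
  rw [hab, Function.comp_assoc, ← Equiv.Perm.coe_mul, mul_inv_cancel]
  rfl

lemma card_wordPairs_le (T S : Tableau d μ) :
    (wordPairs T S).card ≤
      (pairArrangements (colLength μ) (fun e => T.mult e.1 e.2) fun e => S.mult e.1 e.2).card := by
  refine card_le_card_of_injOn (fun p γ => (colFill p.1 γ, colFill p.2 γ)) ?_ ?_
  · intro p hp
    rw [mem_coe] at hp
    rw [mem_coe]
    simp only [pairArrangements, mem_filter_univ]
    refine ⟨colPair_colFill hp, fun e he => ?_⟩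
    simp only [wordPairs, mem_filter_univ] at hp
    have hne := (mem_upperPairs.1 he).ne
    rw [← mem_rowWords.1 hp.1, ← mem_rowWords.1 hp.2.1, ← card_colFill _ hne,
      ← card_colFill _ hne]
    constructor <;> congr!
  · intro p _ q _ h
    refine Prod.ext ?_ ?_
    · funext x
      rw [← colFill_boxCol p.1 x (T.row_lt x), ← colFill_boxCol q.1 x (T.row_lt x)]
      exact congrFun (Prod.mk.inj (congrFun h (boxCol x))).1 _
    · funext x
      rw [← colFill_boxCol p.2 x (T.row_lt x), ← colFill_boxCol q.2 x (T.row_lt x)]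
      exact congrFun (Prod.mk.inj (congrFun h (boxCol x))).2 _

/-- The word whose columns are trivial or filled by `move e`, according to the assignment `f`. -/
def assignedWord (hd : ∀ x : Box μ, x.1.1 < d) (f : Fin (μ.rowLen 0) → Option (Fin d × Fin d))
    (x : Box μ) : Fin d :=
  (f (boxCol x)).elim id move ⟨x.1.1, hd x⟩

section Assigned

variable {hd : ∀ x : Box μ, x.1.1 < d} {m : Fin d × Fin d → ℕ}
  {f : Fin (μ.rowLen 0) → Option (Fin d × Fin d)}

lemma assignedWord_ne_iff (hf : f ∈ moveAssignments (colLength μ) m (upperPairs d)) (x : Box μ) :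
    (assignedWord hd f x : ℕ) ≠ x.1.1 ↔ ∃ e, f (boxCol x) = some e ∧ x.1.1 = e.1 := by
  have h1 := moveAssignments_some hf
  unfold assignedWord
  rcases hfx : f (boxCol x) with _ | e
  · simp
  · simp only [Option.elim_some, Option.some.injEq, exists_eq_left']
    have he := mem_upperPairs.1 (h1 _ _ hfx).1
    unfold move
    by_cases h : x.1.1 = e.1
    · have h' : (⟨x.1.1, hd x⟩ : Fin d) = e.1 := Fin.ext h
      rw [h', Function.update_self]
      simp only [h, iff_true]
      exact fun h2 => he.ne (Fin.ext h2.symm)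
    · have h' : (⟨x.1.1, hd x⟩ : Fin d) ≠ e.1 := fun h2 => h (congrArg Fin.val h2)
      rw [Function.update_of_ne h']
      simp [h]

lemma assignedWord_of_eq {e : Fin d × Fin d} {x : Box μ} (hfx : f (boxCol x) = some e)
    (hx : x.1.1 = e.1) : assignedWord hd f x = e.2 := by
  unfold assignedWord
  rw [hfx]
  have h' : (⟨x.1.1, hd x⟩ : Fin d) = e.1 := Fin.ext hx
  rw [Option.elim_some, h', move, Function.update_self]

lemma wordMult_assignedWord_upper (hf : f ∈ moveAssignments (colLength μ) m (upperPairs d))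
    {e : Fin d × Fin d} (he : e ∈ upperPairs d) :
    wordMult (assignedWord hd f) e.1 e.2 = m e := by
  classical
  have h1 := moveAssignments_some hf
  have h2 := moveAssignments_card hf e he
  have he' := mem_upperPairs.1 he
  rw [← h2]
  refine card_bij (fun x _ => boxCol x) ?_ ?_ ?_
  · intro x hx
    simp only [mem_filter_univ] at hx ⊢
    obtain ⟨e', h3, h4⟩ := (assignedWord_ne_iff (hd := hd) hf x).1 (by
      rw [hx.2, hx.1]
      exact fun h => he'.ne (Fin.ext h.symm))
    rw [h3]
    have h5 := assignedWord_of_eq (hd := hd) h3 h4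
    congr 1
    exact Prod.ext (Fin.ext (h4.symm.trans hx.1)) (h5.symm.trans hx.2)
  · intro x hx y hy h
    simp only [mem_filter_univ] at hx hy
    exact Subtype.ext (Prod.ext (hx.1.trans hy.1.symm) (congrArg Fin.val h))
  · intro γ hγ
    simp only [mem_filter_univ] at hγ
    have hc := (h1 γ e hγ).2
    simp only [mem_crossingCols] at hc
    obtain ⟨x, hx1, hx2, -⟩ := exists_box_of_lt hc.1
    refine ⟨x, ?_, hx2⟩
    simp only [mem_filter_univ]
    exact ⟨hx1, assignedWord_of_eq (by rw [hx2, hγ]) hx1⟩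

lemma row_le_assignedWord (hf : f ∈ moveAssignments (colLength μ) m (upperPairs d)) (x : Box μ) :
    x.1.1 ≤ (assignedWord hd f x : ℕ) := by
  have h1 := moveAssignments_some hf
  by_cases h : (assignedWord hd f x : ℕ) = x.1.1
  · exact h.ge
  · obtain ⟨e, he, hx⟩ := (assignedWord_ne_iff hf x).1 h
    rw [assignedWord_of_eq he hx, hx]
    exact (mem_upperPairs.1 (h1 _ _ he).1).le

lemma colInjective_assignedWord (hf : f ∈ moveAssignments (colLength μ) m (upperPairs d)) :
    ColInjective (assignedWord hd f) := by
  have h1 := moveAssignments_some hf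
  -- an entry off the diagonal exceeds the row numbers in its column
  have key : ∀ x y : Box μ, boxCol x = boxCol y → (assignedWord hd f x : ℕ) ≠ x.1.1 →
      (assignedWord hd f y : ℕ) = y.1.1 → assignedWord hd f x ≠ assignedWord hd f y := by
    intro x y hxy hx hy h
    obtain ⟨e, he, hxe⟩ := (assignedWord_ne_iff hf x).1 hx
    have hc := (h1 _ _ he).2
    simp only [mem_crossingCols] at hc
    rw [assignedWord_of_eq he hxe] at h
    have := row_lt_colLength y
    rw [← hxy, ← hy, ← h] at this
    omega
  intro x y hxy h
  have hcol : boxCol x = boxCol y := Fin.ext hxy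
  refine Subtype.ext (Prod.ext ?_ hxy)
  by_cases hx : (assignedWord hd f x : ℕ) = x.1.1 <;>
    by_cases hy : (assignedWord hd f y : ℕ) = y.1.1
  · rw [← hx, ← hy, h]
  · exact absurd h.symm (key y x hcol.symm hy hx)
  · exact absurd h (key x y hcol hx hy)
  · obtain ⟨e, he, hxe⟩ := (assignedWord_ne_iff hf x).1 hx
    obtain ⟨e', he', hye⟩ := (assignedWord_ne_iff hf y).1 hy
    rw [← hcol, he] at he'
    rw [hxe, hye, Option.some.inj he']

end Assigned

lemma assignedWord_mem_rowWords (T : Tableau d μ)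
    {f : Fin (μ.rowLen 0) → Option (Fin d × Fin d)}
    (hf : f ∈ moveAssignments (colLength μ) (fun e => T.mult e.1 e.2) (upperPairs d)) :
    assignedWord T.row_lt f ∈ rowWords T := by
  rw [mem_rowWords]
  refine fun i j => wordMult_eq_of_ne (fun i j hij => ?_) i j
  rcases lt_or_gt_of_ne hij with h | h
  · exact wordMult_assignedWord_upper (e := (i, j)) hf (mem_upperPairs.2 h)
  · have h2 : wordMult (assignedWord T.row_lt f) i j = 0 := by
      rw [wordMult, card_eq_zero, filter_eq_empty_iff]
      rintro x - ⟨h1, h2⟩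
      have := row_le_assignedWord (hd := T.row_lt) hf x
      rw [h1, h2] at this
      exact absurd h (not_lt.2 this)
    rw [h2]
    exact (T.mult_eq_zero h).symm

/-- A column filled by `move (i, j)` has no entry `i`, so its box in row `i` stays off the diagonal
under every column permutation. If the row contents are preserved, so is the number of
off-diagonal boxes; then all other boxes stay on the diagonal and are fixed by the permutation. -/
lemma assignedWord_mem_rigidWords (T : Tableau d μ)
    {f : Fin (μ.rowLen 0) → Option (Fin d × Fin d)}
    (hf : f ∈ moveAssignments (colLength μ) (fun e => T.mult e.1 e.2) (upperPairs d)) :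
    assignedWord T.row_lt f ∈ rigidWords T := by
  classical
  have hmem := assignedWord_mem_rowWords T hf
  refine mem_filter.2 ⟨hmem, fun τ hτ hτw => ?_⟩
  have h1 := moveAssignments_some hf
  have hinj := colInjective_assignedWord (hd := T.row_lt) hf
  have hτ' := hτ
  simp only [colPerms, mem_filter_univ] at hτ'
  set a := assignedWord T.row_lt f with ha
  have hsub : offDiag a ⊆ offDiag (a ∘ τ) := by
    intro x hx
    simp only [offDiag, mem_filter_univ] at hx ⊢
    obtain ⟨e, he, hxe⟩ := (assignedWord_ne_iff hf x).1 hx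
    intro hx'
    have hcol : boxCol (τ x) = boxCol x := Fin.ext (hτ' x)
    by_cases hτx : (a (τ x) : ℕ) = (τ x).1.1
    · have hrow : (τ x).1.1 = x.1.1 := hτx.symm.trans hx'
      have hfix : τ x = x := Subtype.ext (Prod.ext hrow (hτ' x))
      rw [hfix] at hτx
      exact hx hτx
    · obtain ⟨e', he', hxe'⟩ := (assignedWord_ne_iff hf (τ x)).1 hτx
      rw [hcol, he] at he'
      have hee := Option.some.inj he'
      have hfix : τ x = x :=
        Subtype.ext (Prod.ext (hxe'.trans (by rw [← hee, ← hxe])) (hτ' x))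
      rw [Function.comp, hfix] at hx'
      exact hx hx'
  have hcard : (offDiag (a ∘ τ)).card = (offDiag a).card := by
    rw [card_offDiag _ T.row_lt, card_offDiag _ T.row_lt]
    refine sum_congr rfl fun p _ => ?_
    rw [mem_rowWords.1 hτw, mem_rowWords.1 hmem]
  have heq : offDiag a = offDiag (a ∘ τ) := eq_of_subset_of_card_le hsub hcard.le
  have hfix : ∀ x, x ∉ offDiag a → τ x = x := by
    intro x hx
    have hx' : x ∉ offDiag (a ∘ τ) := heq ▸ hx
    simp only [offDiag, mem_filter_univ, not_not] at hx hx'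
    exact hinj _ _ (hτ' x) (Fin.ext (hx'.trans hx.symm))
  ext1 x
  rw [Equiv.Perm.one_apply]
  by_cases hx : x ∈ offDiag a
  · by_cases hτx : τ x ∈ offDiag a
    · simp only [offDiag, mem_filter_univ] at hx hτx
      obtain ⟨e, he, hxe⟩ := (assignedWord_ne_iff hf x).1 hx
      obtain ⟨e', he', hxe'⟩ := (assignedWord_ne_iff hf (τ x)).1 hτx
      rw [show boxCol (τ x) = boxCol x from Fin.ext (hτ' x), he] at he'
      have hee := Option.some.inj he'
      exact Subtype.ext (Prod.ext (hxe'.trans (by rw [← hee, ← hxe])) (hτ' x))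
    · exact τ.injective (hfix _ hτx)
  · exact hfix x hx

lemma card_moveAssignments_le (T : Tableau d μ) :
    (moveAssignments (colLength μ) (fun e => T.mult e.1 e.2) (upperPairs d)).card ≤
      (rigidWords T).card := by
  refine card_le_card_of_injOn (assignedWord T.row_lt)
    (fun f hf => mem_coe.2 (assignedWord_mem_rigidWords T hf)) ?_
  intro f hf f' hf' h
  rw [mem_coe] at hf hf'
  have key : ∀ f ∈ moveAssignments (colLength μ) (fun e => T.mult e.1 e.2) (upperPairs d),
      ∀ f' ∈ moveAssignments (colLength μ) (fun e => T.mult e.1 e.2) (upperPairs d),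
      assignedWord T.row_lt f = assignedWord T.row_lt f' → ∀ γ e, f γ = some e →
        f' γ = some e := by
    intro f hf f' hf' h γ e he
    have hc := moveAssignments_some hf γ e he
    simp only [mem_crossingCols] at hc
    obtain ⟨x, hx1, hx2, -⟩ := exists_box_of_lt hc.2.1
    have hxe : f (boxCol x) = some e := by rw [hx2, he]
    have hx := (assignedWord_ne_iff (hd := T.row_lt) hf x).2 ⟨e, hxe, hx1⟩
    rw [h] at hx
    obtain ⟨e', he', hx1'⟩ := (assignedWord_ne_iff hf' x).1 hx
    have h2 := assignedWord_of_eq (hd := T.row_lt) hxe hx1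
    rw [h, assignedWord_of_eq he' hx1'] at h2
    rw [← hx2, he']
    congr 1
    exact Prod.ext (Fin.ext (hx1'.symm.trans hx1)) h2
  funext γ
  rcases h1 : f γ with _ | e
  · rcases h2 : f' γ with _ | e'
    · rfl
    · rw [key f' hf' f hf h.symm γ e' h2] at h1
      exact absurd h1 (by simp)
  · exact (key f hf f' hf' h γ e h1).symm

end Fillings

/-! ### Multiplicities and the overlap estimate -/

section Multiplicities

variable {d : ℕ} {μ : YoungDiagram}

lemma sum_upperPairs {R : Type*} [AddCommMonoid R] (f : Fin d → Fin d → R) :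
    ∑ e ∈ upperPairs d, f e.1 e.2 = ∑ i, ∑ j ∈ Ioi i, f i j := by
  rw [upperPairs, sum_filter, Fintype.sum_prod_type]
  refine sum_congr rfl fun i _ => ?_
  rw [← sum_filter, filter_lt_eq_Ioi]

lemma Tableau.total_eq (T : Tableau d μ) :
    T.total = ∑ e ∈ upperPairs d, T.mult e.1 e.2 :=
  (sum_upperPairs _).symm

lemma Tableau.diff_eq (T S : Tableau d μ) :
    T.diff S = ∑ e ∈ upperPairs d, ((T.mult e.1 e.2 : ℤ) - S.mult e.1 e.2).natAbs :=
  (sum_upperPairs fun i j => ((T.mult i j : ℤ) - S.mult i j).natAbs).symm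

lemma Tableau.mult_le_total (T : Tableau d μ) {e : Fin d × Fin d} (he : e ∈ upperPairs d) :
    T.mult e.1 e.2 ≤ T.total := by
  rw [T.total_eq]
  exact single_le_sum (f := fun e : Fin d × Fin d => T.mult e.1 e.2)
    (fun _ _ => Nat.zero_le _) he

lemma Tableau.total_le_total_add_diff (T S : Tableau d μ) : T.total ≤ S.total + T.diff S := by
  rw [T.total_eq, S.total_eq, T.diff_eq, ← sum_add_distrib]
  refine sum_le_sum fun e _ => ?_
  omega

lemma Tableau.diff_le_total_add_total (T S : Tableau d μ) : T.diff S ≤ T.total + S.total := by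
  rw [T.total_eq, S.total_eq, T.diff_eq, ← sum_add_distrib]
  refine sum_le_sum fun e _ => ?_
  omega

lemma Tableau.sum_mul_shift (T : Tableau d μ) :
    ∑ i : Fin d, ((i : ℕ) : ℤ) * T.shift i =
      -∑ e ∈ upperPairs d, (((e.2 : ℕ) : ℤ) - ((e.1 : ℕ) : ℤ)) * T.mult e.1 e.2 := by
  have h1 : ∑ i : Fin d, ∑ j ∈ Iio i, ((i : ℕ) : ℤ) * (T.mult j i : ℤ) =
      ∑ e ∈ upperPairs d, ((e.2 : ℕ) : ℤ) * T.mult e.1 e.2 := by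
    rw [sum_upperPairs fun i j : Fin d => ((j : ℕ) : ℤ) * (T.mult i j : ℤ)]
    exact sum_comm' (by simp)
  have h2 : ∑ i : Fin d, ∑ j ∈ Ioi i, ((i : ℕ) : ℤ) * (T.mult i j : ℤ) =
      ∑ e ∈ upperPairs d, ((e.1 : ℕ) : ℤ) * T.mult e.1 e.2 :=
    (sum_upperPairs fun i j : Fin d => ((i : ℕ) : ℤ) * (T.mult i j : ℤ)).symm
  simp only [Tableau.shift, mul_sub, mul_sum, sum_sub_distrib, sub_mul]
  rw [h1, h2]
  ring

/-- Two different families of multiplicities with the same shifts differ by a vector with entries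
of both signs, because `∑ (j - i) (m_{ij} - l_{ij}) = 0`. -/
lemma Tableau.total_lt_of_shift_eq {T S : Tableau d μ} (h : ∀ i, T.shift i = S.shift i)
    (hD : 1 ≤ T.diff S) : T.total < S.total + T.diff S := by
  refine lt_of_le_of_ne (T.total_le_total_add_diff S) fun heq => ?_
  rw [T.total_eq, S.total_eq, T.diff_eq, ← sum_add_distrib] at heq
  have hle : ∀ e ∈ upperPairs d, T.mult e.1 e.2 ≤
      S.mult e.1 e.2 + ((T.mult e.1 e.2 : ℤ) - S.mult e.1 e.2).natAbs := fun e _ => by omega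
  have heach := (sum_eq_sum_iff_of_le hle).1 heq
  have hw : ∑ e ∈ upperPairs d,
      (((e.2 : ℕ) : ℤ) - ((e.1 : ℕ) : ℤ)) * ((T.mult e.1 e.2 : ℤ) - S.mult e.1 e.2) = 0 := by
    have h1 := T.sum_mul_shift
    have h2 := S.sum_mul_shift
    simp only [h] at h1
    simp only [mul_sub, sum_sub_distrib] at h1 h2 ⊢
    linarith
  have hnonneg : ∀ e ∈ upperPairs d,
      0 ≤ (((e.2 : ℕ) : ℤ) - ((e.1 : ℕ) : ℤ)) * ((T.mult e.1 e.2 : ℤ) - S.mult e.1 e.2) := by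
    intro e he
    have h1 : (e.1 : ℕ) < e.2 := mem_upperPairs.1 he
    have h2 := heach e he
    apply mul_nonneg <;> omega
  have hzero := (sum_eq_zero_iff_of_nonneg hnonneg).1 hw
  have : T.diff S = 0 := by
    rw [T.diff_eq]
    refine sum_eq_zero fun e he => ?_
    have h1 : (e.1 : ℕ) < e.2 := mem_upperPairs.1 he
    rcases mul_eq_zero.1 (hzero e he) with h2 | h2
    · omega
    · rw [h2]
      rfl
  omega

/-- A tableau is determined by its multiplicities. -/
lemma Tableau.eq_of_diff_eq_zero {T S : Tableau d μ} (h : T.diff S = 0) : T = S := by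
  have hmult : ∀ i j, T.mult i j = S.mult i j := by
    refine wordMult_eq_of_ne fun i j hij => ?_
    change T.mult i j = S.mult i j
    rcases lt_or_gt_of_ne hij with hlt | hlt
    · rw [T.diff_eq, sum_eq_zero_iff] at h
      have := h (i, j) (mem_upperPairs.2 hlt)
      simp only at this
      omega
    · rw [T.mult_eq_zero hlt, S.mult_eq_zero hlt]
  have hle : ∀ T S : Tableau d μ, (∀ i j, T.mult i j = S.mult i j) → ∀ x : Box μ,
      S.word x ≤ T.word x := by
    intro T S hmult x
    by_contra hlt
    push Not at hlt
    have hsum : ∀ (U : Tableau d μ) (v : Fin d),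
        (univ.filter fun y : Box μ => y.1.1 = x.1.1 ∧ U.word y ≤ v).card =
          ∑ k ∈ Iic v, U.mult ⟨x.1.1, U.row_lt x⟩ k := by
      intro U v
      rw [card_eq_sum_card_fiberwise (f := U.word) (t := Iic v)
        (fun y hy => by simpa using (mem_filter.1 hy).2.2)]
      refine sum_congr rfl fun k hk => ?_
      rw [filter_filter, Tableau.mult]
      congr 1
      ext y
      simp only [mem_filter_univ]
      constructor
      · rintro ⟨⟨h1, -⟩, h2⟩
        exact ⟨h1, h2⟩
      · rintro ⟨h1, h2⟩
        exact ⟨⟨h1, h2 ▸ mem_Iic.1 hk⟩, h2⟩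
    have hEq : (univ.filter fun y : Box μ => y.1.1 = x.1.1 ∧ T.word y ≤ T.word x).card =
        (univ.filter fun y : Box μ => y.1.1 = x.1.1 ∧ S.word y ≤ T.word x).card := by
      rw [hsum, hsum]
      exact sum_congr rfl fun k _ => hmult _ _
    -- entries of `S` up to `T.word x` lie to the left of `x`, where those of `T` are as small
    have hmono : ∀ (U : Tableau d μ) (y z : Box μ), y.1.1 = z.1.1 → y.1.2 ≤ z.1.2 →
        U.word y ≤ U.word z := by
      rintro U ⟨⟨i, c⟩, hy⟩ ⟨⟨i', c'⟩, hz⟩ h1 h2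
      simp only at h1 h2
      subst h1
      exact U.1.row_weak_of_le h2 hz
    have hss : (univ.filter fun y : Box μ => y.1.1 = x.1.1 ∧ S.word y ≤ T.word x) ⊂
        (univ.filter fun y : Box μ => y.1.1 = x.1.1 ∧ T.word y ≤ T.word x) := by
      rw [ssubset_iff_of_subset]
      · exact ⟨x, by simp, by simpa using hlt⟩
      · intro y hy
        simp only [mem_filter_univ] at hy ⊢
        refine ⟨hy.1, hmono T y x hy.1 ?_⟩
        by_contra hc
        exact absurd (hmono S x y hy.1.symm (not_le.1 hc).le) (not_le.2 (lt_of_le_of_lt hy.2 hlt))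
    exact absurd hEq (card_lt_card hss).ne'
  have hword : T.word = S.word :=
    funext fun x => le_antisymm (hle S T (fun i j => (hmult i j).symm) x) (hle T S hmult x)
  refine Subtype.ext (SemistandardYoungTableau.ext fun i j => ?_)
  by_cases hij : (i, j) ∈ μ
  · exact congrArg Fin.val (congrFun hword ⟨(i, j), hij⟩)
  · rw [T.1.zeros hij, S.1.zeros hij]

/-- The constant of the overlap estimate. -/
noncomputable def overlapConst (d : ℕ) : ℝ :=
  2 * Real.exp (Fintype.card ((Fin d → Fin d) × (Fin d → Fin d)))

/-- The overlap estimate, for all admissible `ρ` and `θ`: the number of pairs of words divided by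
the geometric mean of the numbers of rigid words. -/
theorem norm_inner_ket_mul_le (T S : Tableau d μ) {M G ρ θ : ℝ} (hM : 1 ≤ M)
    (hρ : 1 ≤ ρ) (hθ : 1 ≤ θ) (hG : (ρ ^ 3 * θ) ^ 2 * M ^ 3 ≤ G)
    (hg : ∀ e ∈ upperPairs d, G ≤ ((μ.rowLen e.1 - μ.rowLen e.2 : ℕ) : ℝ))
    (hle : S.total ≤ T.total) (hTM : (T.total : ℝ) ≤ M) (hTG : 2 * (T.total : ℝ) ^ 2 ≤ G) :
    ‖inner ℂ T.ket S.ket‖ * (ρ ^ T.diff S * θ ^ (T.total - S.total)) ≤ overlapConst d := by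
  have hG0 : 0 < G := lt_of_lt_of_le (by positivity) hG
  have hg' : ∀ e ∈ upperPairs d, G ≤ ((crossingCols (colLength μ) e).card : ℝ) := by
    intro e he
    rw [card_crossingCols]
    exact hg e he
  have hle' : (S.total : ℝ) ≤ T.total := by exact_mod_cast hle
  have hg0 : ∀ e ∈ upperPairs d, 0 < (crossingCols (colLength μ) e).card := by
    intro e he
    have := lt_of_lt_of_le hG0 (hg' e he)
    exact_mod_cast this
  set g : Fin d × Fin d → ℝ := fun e => ((crossingCols (colLength μ) e).card : ℝ) with hgdef
  set Φ : Tableau d μ → ℝ := fun U => choiceWeight g fun e => U.mult e.1 e.2 with hΦ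
  have hΦ0 : ∀ U, 0 < Φ U := by
    intro U
    refine prod_pos fun e he => ?_
    have := lt_of_lt_of_le hG0 (hg' e he)
    positivity
  have hlow : ∀ U : Tableau d μ, (U.total : ℝ) ≤ T.total → Φ U / 2 ≤ ((rigidWords U).card : ℝ) := by
    intro U hU
    refine (choiceWeight_le_card_moveAssignments (colLength μ) (fun e => U.mult e.1 e.2)
      U.total_eq.symm (fun e he => ?_) hg0).trans (Nat.cast_le.2 (card_moveAssignments_le U))
    refine le_trans ?_ (hg' e he)
    refine le_trans ?_ hTG
    gcongr
  have hpos : ∀ U : Tableau d μ, (U.total : ℝ) ≤ T.total → 0 < (rigidWords U).card := by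
    intro U hU
    have := lt_of_lt_of_le (half_pos (hΦ0 U)) (hlow U hU)
    exact_mod_cast this
  have hup := card_pairArrangements_le (colLength μ) (fun e => T.mult e.1 e.2)
    (fun e => S.mult e.1 e.2) hM hρ hθ hG hg'
    (fun e he => le_trans (by exact_mod_cast T.mult_le_total he) hTM)
    (fun e he => le_trans (by exact_mod_cast S.mult_le_total he) (hle'.trans hTM))
    (T.diff_eq S).symm (Δ := T.total - S.total) (by
      rw [← T.total_eq, ← S.total_eq]
      omega)
  have hpair : ((wordPairs T S).card : ℝ) ≤ ((pairArrangements (colLength μ)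
      (fun e => T.mult e.1 e.2) fun e => S.mult e.1 e.2).card : ℝ) :=
    Nat.cast_le.2 (card_wordPairs_le T S)
  have hin := norm_inner_ket_le T S (hpos T le_rfl) (hpos S hle')
  have hsq : √(Φ T) * √(Φ S) / 2 ≤ √((rigidWords T).card) * √((rigidWords S).card) := by
    calc √(Φ T) * √(Φ S) / 2 = √(Φ T / 2) * √(Φ S / 2) := by
          rw [Real.sqrt_div (hΦ0 T).le, Real.sqrt_div (hΦ0 S).le, div_mul_div_comm,
            Real.mul_self_sqrt zero_le_two]
      _ ≤ _ := mul_le_mul (Real.sqrt_le_sqrt (hlow T le_rfl)) (Real.sqrt_le_sqrt (hlow S hle'))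
          (Real.sqrt_nonneg _) (Real.sqrt_nonneg _)
  have hT := Real.sqrt_pos.2 (hΦ0 T)
  have hS := Real.sqrt_pos.2 (hΦ0 S)
  calc ‖inner ℂ T.ket S.ket‖ * (ρ ^ T.diff S * θ ^ (T.total - S.total))
      ≤ ((wordPairs T S).card / (√(Φ T) * √(Φ S) / 2)) *
          (ρ ^ T.diff S * θ ^ (T.total - S.total)) := by
        refine mul_le_mul_of_nonneg_right (hin.trans ?_) (by positivity)
        exact div_le_div_of_nonneg_left (Nat.cast_nonneg _) (by positivity) hsq
    _ = ((wordPairs T S).card * (ρ ^ T.diff S * θ ^ (T.total - S.total))) /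
          (√(Φ T) * √(Φ S) / 2) := by ring
    _ ≤ (√(Φ T) * √(Φ S) * Real.exp (Fintype.card ((Fin d → Fin d) × (Fin d → Fin d)))) /
          (√(Φ T) * √(Φ S) / 2) := by
        refine div_le_div_of_nonneg_right (le_trans ?_ hup) (by positivity)
        exact mul_le_mul_of_nonneg_right hpair (by positivity)
    _ = overlapConst d := by
        unfold overlapConst
        field_simp

end Multiplicities

/-! ### Comparison with the bound -/

section Bounds

lemma two_le_overlapConst (d : ℕ) : 2 ≤ overlapConst d := by
  unfold overlapConst
  have : (1 : ℝ) ≤ Real.exp (Fintype.card ((Fin d → Fin d) × (Fin d → Fin d))) :=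
    Real.one_le_exp (Nat.cast_nonneg _)
  linarith

/-- The logarithm of the bound with `K = 0`. -/
lemma quasiBound_eq_exp {C' η δ : ℝ} {n : ℕ} (M L D : ℕ) (hC : 0 < C') (hδ : 0 < δ) (hn : 0 < n) :
    quasiBound C' 0 η δ n M L D =
      Real.exp ((-η * ((M : ℝ) - L) / 4 + (9 * η - 2) * D / 12) * (Real.log C' + Real.log n) +
        (((M : ℝ) - L) / 2 - (D : ℝ) / 3) * Real.log δ) := by
  have hn' : (0 : ℝ) < n := by exact_mod_cast hn
  unfold quasiBound
  rw [Real.rpow_def_of_pos (by positivity), Real.rpow_def_of_pos (by positivity),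
    Real.rpow_def_of_pos hδ, Real.log_mul hC.ne' hn'.ne', ← Real.exp_add, ← Real.exp_add, zero_mul,
    add_zero, mul_one]
  congr 1
  ring

/-- The exponents of the two available estimates for the overlap, `(δ n^{1-3η})^{-D/6}` and
`(δ n^{1-3η})^{-Δ/2}`, compared with those of the bound; here `a = log n`, `b = -log δ`. -/
lemma exponent_le {a b η D Δ t : ℝ} (hb : 0 ≤ b) (hab : 2 * b ≤ (1 - 3 * η) * a)
    (h1 : t ≤ -(D / 6) * ((1 - 3 * η) * a - b)) (h2 : t ≤ -(Δ / 2) * ((1 - 3 * η) * a - b)) :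
    t ≤ -(η * (D - Δ) / 4 * a) +
      ((-η * Δ / 4 + (9 * η - 2) * D / 12) * a - (Δ / 2 - D / 3) * b) := by
  rcases le_total (3 * Δ) D with h | h
  · nlinarith [mul_nonneg hb (sub_nonneg.2 h)]
  · nlinarith [mul_nonneg (sub_nonneg.2 hab) (sub_nonneg.2 h)]

/-- The constant `C'` of the bound. For small `η` the exponent of `C' n` is at most `-1/12` and a
small `C'` absorbs the overlap constant; for larger `η` the overlap estimate is better than the
bound by a power of `n` that does so. -/
noncomputable def boundConst (d : ℕ) (η : ℝ) : ℝ :=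
  if η ≤ 1 / 9 then Real.exp (-12 * Real.log (overlapConst d)) else 1

lemma boundConst_pos (d : ℕ) (η : ℝ) : 0 < boundConst d η := by
  unfold boundConst
  split_ifs
  · exact Real.exp_pos _
  · exact one_pos

lemma log_overlapConst_le {d : ℕ} {a η D Δ : ℝ} (hη : η < 1 / 3) (hη0 : 0 ≤ η) (ha : 0 ≤ a)
    (hΔ0 : 0 ≤ Δ) (hΔ : Δ + 1 ≤ D) (hC : 36 * Real.log (overlapConst d) ≤ (1 - 3 * η) * a) :
    Real.log (overlapConst d) - η * (D - Δ) / 4 * a ≤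
      (-η * Δ / 4 + (9 * η - 2) * D / 12) * Real.log (boundConst d η) := by
  have hc : 0 ≤ Real.log (overlapConst d) :=
    Real.log_nonneg (by linarith [two_le_overlapConst d])
  have h1 : η * a / 4 ≤ η * (D - Δ) / 4 * a := by
    have := mul_nonneg (mul_nonneg hη0 ha) (by linarith : 0 ≤ D - Δ - 1)
    nlinarith
  unfold boundConst
  split_ifs with h
  · rw [Real.log_exp]
    have h2 : 1 ≤ 3 * (η * Δ) + (2 - 9 * η) * D := by
      have := mul_nonneg hη0 hΔ0
      nlinarith
    have h3 := mul_nonneg hc (sub_nonneg.2 h2)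
    have h4 := mul_nonneg hη0 ha
    nlinarith
  · rw [Real.log_one, mul_zero]
    push Not at h
    have h2 : (1 - 3 * η) * a ≤ 9 * (η * a) := by nlinarith
    linarith

variable {d : ℕ} {μ : YoungDiagram}

/-- Consecutive gaps bound all gaps between row lengths. -/
lemma gap_le {δ : ℝ} {n : ℕ}
    (hgap : ∀ i : ℕ, i + 1 < d → δ * n < (μ.rowLen i : ℝ) - μ.rowLen (i + 1)) :
    ∀ e ∈ upperPairs d, δ * n ≤ ((μ.rowLen e.1 - μ.rowLen e.2 : ℕ) : ℝ) := by
  intro e he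
  have h1 : (e.1 : ℕ) < e.2 := mem_upperPairs.1 he
  have h2 : μ.rowLen e.2 ≤ μ.rowLen (e.1 + 1) := μ.rowLen_anti _ _ h1
  have h3 : μ.rowLen e.2 ≤ μ.rowLen e.1 := μ.rowLen_anti _ _ h1.le
  have h4 := hgap e.1 (lt_of_le_of_lt h1 e.2.2)
  have h5 : (μ.rowLen e.2 : ℝ) ≤ μ.rowLen (e.1 + 1) := by exact_mod_cast h2
  rw [Nat.cast_sub h3]
  linarith

lemma rowLen_le_card (i : ℕ) : μ.rowLen i ≤ μ.card := by
  rw [YoungDiagram.rowLen_eq_card]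
  exact card_le_card (filter_subset _ _)

lemma Tableau.norm_ket_le (T : Tableau d μ) : ‖T.ket‖ ≤ 1 := by
  rw [Tableau.ket, norm_smul, Complex.norm_real, norm_inv, norm_norm]
  exact inv_mul_le_one

/-- The bound with `K = 0`, for `C = overlapConst d ^ 36` and `C' = boundConst d η`. The two overlap
estimates come from `(ρ, θ) = (B^{1/6}, 1)` and `(ρ, θ) = (1, B^{1/2})`, `B = δ n^{1-3η}`. -/
theorem norm_inner_ket_le_quasiBound {η δ : ℝ} (hη : η < 1 / 3) (hδ : 0 < δ) {n : ℕ}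
    (hn : μ.card = n) (T S : Tableau d μ) (hshift : ∀ i, T.shift i = S.shift i)
    (hgap : ∀ i : ℕ, i + 1 < d → δ * n < (μ.rowLen i : ℝ) - μ.rowLen (i + 1))
    (hle : S.total ≤ T.total) (hT : (T.total : ℝ) ≤ (n : ℝ) ^ η)
    (hC : overlapConst d ^ 36 * (n : ℝ) ^ (3 * η - 1) / δ ^ 2 < 1) :
    ‖inner ℂ T.ket S.ket‖ ≤ quasiBound (boundConst d η) 0 η δ n T.total S.total (T.diff S) := by
  rcases Nat.eq_zero_or_pos (T.diff S) with hD | hD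
  · -- equal tableaux: the bound is one
    have hTS := Tableau.eq_of_diff_eq_zero hD
    subst hTS
    calc ‖inner ℂ T.ket T.ket‖ ≤ ‖T.ket‖ * ‖T.ket‖ := norm_inner_le_norm _ _
      _ ≤ 1 := mul_le_one₀ T.norm_ket_le (norm_nonneg _) T.norm_ket_le
      _ = _ := by simp [quasiBound, hD]
  have hlt := Tableau.total_lt_of_shift_eq hshift hD
  have hTpos : 1 ≤ T.total := by
    have := T.diff_le_total_add_total S
    omega
  have hTpos' : (1 : ℝ) ≤ T.total := by exact_mod_cast hTpos
  have hM : 1 ≤ (n : ℝ) ^ η := hTpos'.trans hT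
  -- there is at least one pair of rows, so that `0 < δ < 1` and `0 < n`
  obtain ⟨e, he⟩ : (upperPairs d).Nonempty := by
    rw [nonempty_iff_ne_empty]
    intro h
    rw [T.total_eq, h, sum_empty] at hTpos
    omega
  have hed := lt_of_le_of_lt (show (e.1 : ℕ) + 1 ≤ e.2 from mem_upperPairs.1 he) e.2.2
  have hge := hgap e.1 hed
  have hrow : (μ.rowLen e.1 : ℝ) ≤ n := by
    rw [← hn]
    exact_mod_cast rowLen_le_card _
  have hδn : δ * n < n := by
    have : (0 : ℝ) ≤ μ.rowLen (e.1 + 1) := Nat.cast_nonneg _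
    linarith
  have hn0 : (0 : ℝ) < n := by
    rcases eq_or_lt_of_le (Nat.cast_nonneg (α := ℝ) n) with h | h
    · rw [← h, mul_zero] at hδn
      exact absurd hδn (lt_irrefl _)
    · exact h
  have hδ1 : δ < 1 := by
    by_contra h
    nlinarith
  have hnpos : 0 < n := by exact_mod_cast hn0
  have hn1 : (1 : ℝ) ≤ n := by exact_mod_cast hnpos
  set a := Real.log n with ha
  set b := -Real.log δ with hb
  have ha0 : 0 ≤ a := Real.log_nonneg hn1
  have hb0 : 0 < b := by
    rw [hb]
    linarith [Real.log_neg hδ hδ1]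
  have hc2 := two_le_overlapConst d
  have hc0 : 0 < overlapConst d := by linarith
  have hlogc : Real.log 2 ≤ Real.log (overlapConst d) := Real.log_le_log zero_lt_two hc2
  have hlog2 : 0 < Real.log 2 := Real.log_pos one_lt_two
  -- the smallness assumption in logarithmic form
  have hlogC : 36 * Real.log (overlapConst d) + 2 * b < (1 - 3 * η) * a := by
    rw [div_lt_one (by positivity)] at hC
    have h1 := Real.log_lt_log (by positivity) hC
    rw [Real.log_mul (by positivity) (by positivity), Real.log_pow, Real.log_pow,
      Real.log_rpow hn0] at h1
    push_cast at h1
    rw [hb]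
    linarith
  have hη0 : 0 ≤ η := by
    by_contra hneg
    push Not at hneg
    have h1 : η * a < 0 := by
      apply mul_neg_of_neg_of_pos hneg
      rcases eq_or_lt_of_le ha0 with h | h
      · rw [← h, mul_zero] at hlogC
        linarith
      · exact h
    have h2 : 0 ≤ η * a := by
      rw [ha, ← Real.log_rpow hn0]
      exact Real.log_nonneg hM
    linarith
  have hηa : 0 ≤ η * a := mul_nonneg hη0 ha0
  -- `B = δ n^{1-3η}` is the ratio of the gap and the cube of `n^η`
  have hlogB : 0 ≤ (1 - 3 * η) * a - b := by linarith
  set B := Real.exp ((1 - 3 * η) * a - b) with hBdef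
  have hMexp : (n : ℝ) ^ η = Real.exp (η * a) := by
    rw [Real.rpow_def_of_pos hn0, mul_comm]
  have hGexp : δ * n = Real.exp (a - b) := by
    rw [Real.exp_sub, hb, ha, Real.exp_log hn0, Real.exp_neg, Real.exp_log hδ]
    field_simp
  have hBG : B * ((n : ℝ) ^ η) ^ 3 = δ * n := by
    rw [hBdef, hMexp, hGexp, ← Real.exp_nat_mul, ← Real.exp_add]
    congr 1
    push_cast
    ring
  have hTG : 2 * (T.total : ℝ) ^ 2 ≤ δ * n := by
    calc 2 * (T.total : ℝ) ^ 2 ≤ 2 * ((n : ℝ) ^ η) ^ 2 := by gcongr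
      _ = Real.exp (Real.log 2 + 2 * (η * a)) := by
          rw [Real.exp_add, Real.exp_log zero_lt_two, hMexp, ← Real.exp_nat_mul]
          push_cast
          rfl
      _ ≤ δ * n := by
          rw [hGexp, Real.exp_le_exp]
          linarith
  have hest := fun (ρ θ : ℝ) (hρ : 1 ≤ ρ) (hθ : 1 ≤ θ) (h : (ρ ^ 3 * θ) ^ 2 = B) =>
    norm_inner_ket_mul_le T S hM hρ hθ (h ▸ hBG.le) (gap_le hgap) hle hT hTG
  rcases eq_or_lt_of_le (norm_nonneg (inner ℂ T.ket S.ket)) with h0 | hpos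
  · rw [← h0, quasiBound_eq_exp _ _ _ (boundConst_pos d η) hδ hnpos]
    exact (Real.exp_pos _).le
  set t := Real.log ‖inner ℂ T.ket S.ket‖ with ht
  set Δ : ℝ := (T.total : ℝ) - S.total with hΔdef
  have hΔcast : ((T.total - S.total : ℕ) : ℝ) = Δ := by rw [Nat.cast_sub hle]
  have hest1 : t - Real.log (overlapConst d) ≤
      -((T.diff S : ℝ) / 6) * ((1 - 3 * η) * a - b) := by
    have h1 := hest (Real.exp (((1 - 3 * η) * a - b) / 6)) 1 (Real.one_le_exp (by linarith)) le_rfl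
      (by
        rw [mul_one, ← pow_mul, ← Real.exp_nat_mul, hBdef]
        congr 1
        push_cast
        ring)
    have h2 := Real.log_le_log (by positivity) h1
    rw [one_pow, mul_one, Real.log_mul hpos.ne' (by positivity), Real.log_pow, Real.log_exp] at h2
    linarith
  have hest2 : t - Real.log (overlapConst d) ≤ -(Δ / 2) * ((1 - 3 * η) * a - b) := by
    have h1 := hest 1 (Real.exp (((1 - 3 * η) * a - b) / 2)) le_rfl (Real.one_le_exp (by linarith))
      (by
        rw [one_pow, one_mul, ← Real.exp_nat_mul, hBdef]
        congr 1
        push_cast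
        ring)
    have h2 := Real.log_le_log (by positivity) h1
    rw [one_pow, one_mul, Real.log_mul hpos.ne' (by positivity), Real.log_pow, Real.log_exp,
      hΔcast] at h2
    linarith
  have hΔ0 : 0 ≤ Δ := by
    rw [hΔdef, sub_nonneg]
    exact_mod_cast hle
  have hΔD : Δ + 1 ≤ T.diff S := by
    have : ((T.total + 1 : ℕ) : ℝ) ≤ ((S.total + T.diff S : ℕ) : ℝ) := by exact_mod_cast hlt
    push_cast at this
    rw [hΔdef]
    linarith
  have hfinal := exponent_le hb0.le (by linarith) hest1 hest2
  have hconst := log_overlapConst_le (d := d) hη hη0 ha0 hΔ0 hΔD (by linarith)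
  rw [quasiBound_eq_exp _ _ _ (boundConst_pos d η) hδ hnpos, ← Real.log_le_iff_le_exp hpos]
  have hδb : Real.log δ = -b := by rw [hb, neg_neg]
  rw [hδb]
  linarith

/-- The order of the bound: the exponents of `C'` and `δ` are at most proportional to `D`. -/
theorem quasiBound_le {C' η δ : ℝ} (hC : 0 < C') (hδ : 0 < δ) :
    ∃ A : ℝ, 1 ≤ A ∧ ∀ (n : ℕ) (μ : YoungDiagram) (m l : Tableau d μ), μ.card = n →
      l.total ≤ m.total → (m.total : ℝ) ≤ (n : ℝ) ^ η →
      quasiBound C' 0 η δ n m.total l.total (m.diff l) ≤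
        A ^ (1 + m.diff l) * (n : ℝ) ^ ((9 * η - 2) * (m.diff l : ℝ) / 12) := by
  set κ := (|η| + |9 * η - 2|) * |Real.log C'| + |Real.log δ| with hκ
  have hκ0 : 0 ≤ κ := by positivity
  refine ⟨Real.exp κ, Real.one_le_exp hκ0, fun n μ m l hn hle hm => ?_⟩
  have hD := m.diff_le_total_add_total l
  rcases Nat.eq_zero_or_pos n with rfl | hnpos
  · -- the empty diagram has only the empty tableau
    have hbox : IsEmpty (Box μ) := by
      rw [isEmpty_coe_sort]
      exact card_eq_zero.1 hn
    have hm0 : m.total = 0 := by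
      rw [m.total_eq]
      refine sum_eq_zero fun e _ => ?_
      simp [Tableau.mult]
    have hl0 : l.total = 0 := by omega
    have hD0 : m.diff l = 0 := by omega
    rw [hm0, hl0, hD0]
    simpa [quasiBound] using hκ0
  have hn0 : (0 : ℝ) < n := by exact_mod_cast hnpos
  have hn1 : (1 : ℝ) ≤ n := by exact_mod_cast hnpos
  rw [quasiBound_eq_exp _ _ _ hC hδ hnpos, Real.rpow_def_of_pos hn0, ← Real.exp_nat_mul,
    ← Real.exp_add, Real.exp_le_exp]
  set a := Real.log n with ha
  have ha0 : 0 ≤ a := Real.log_nonneg hn1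
  set D : ℝ := (m.diff l : ℝ)
  set Δ : ℝ := (m.total : ℝ) - l.total with hΔ
  have hΔ0 : 0 ≤ Δ := by
    rw [hΔ, sub_nonneg]
    exact_mod_cast hle
  have hΔD : Δ ≤ D := by
    have : (m.total : ℝ) ≤ l.total + m.diff l := by exact_mod_cast m.total_le_total_add_diff l
    rw [hΔ]
    linarith
  -- for negative `η` either `n = 1` or both tableaux have no off-diagonal entries
  have hηΔ : 0 ≤ η * Δ * a := by
    rcases le_or_gt 0 η with h | h
    · positivity
    · rcases eq_or_lt_of_le ha0 with h0 | h0
      · rw [← h0, mul_zero]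
      · have h1 : (n : ℝ) ^ η < 1 := by
          rw [Real.rpow_def_of_pos hn0, Real.exp_lt_one_iff]
          exact mul_neg_of_pos_of_neg h0 h
        have h2 : m.total = 0 := by
          have := lt_of_le_of_lt hm h1
          exact Nat.lt_one_iff.1 (by exact_mod_cast this)
        have h3 : l.total = 0 := by omega
        rw [hΔ, h2, h3]
        simp
  have hE : (-η * Δ / 4 + (9 * η - 2) * D / 12) * Real.log C' ≤
      D * ((|η| + |9 * η - 2|) * |Real.log C'|) := by
    refine (le_abs_self _).trans ?_
    rw [abs_mul, ← mul_assoc]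
    refine mul_le_mul_of_nonneg_right ?_ (abs_nonneg _)
    refine (abs_add_le _ _).trans ?_
    rw [abs_div, abs_div, abs_mul, abs_mul, abs_neg, abs_of_nonneg hΔ0,
      abs_of_nonneg (hΔ0.trans hΔD), abs_of_pos (by norm_num : (0 : ℝ) < 4),
      abs_of_pos (by norm_num : (0 : ℝ) < 12)]
    have h1 : |η| * Δ ≤ |η| * D := mul_le_mul_of_nonneg_left hΔD (abs_nonneg _)
    have h2 : 0 ≤ |η| * D := mul_nonneg (abs_nonneg _) (hΔ0.trans hΔD)
    have h3 : 0 ≤ |9 * η - 2| * D := mul_nonneg (abs_nonneg _) (hΔ0.trans hΔD)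
    linarith
  have hF : (Δ / 2 - D / 3) * Real.log δ ≤ D * |Real.log δ| := by
    refine (le_abs_self _).trans ?_
    rw [abs_mul]
    refine mul_le_mul_of_nonneg_right ?_ (abs_nonneg _)
    rw [abs_le]
    constructor <;> linarith
  have hcast : ((1 + m.diff l : ℕ) : ℝ) = 1 + D := by push_cast; rfl
  rw [hcast, hκ]
  nlinarith

/-- For `η < 2/9` the bound is at most a power of `A² n^{-(2-9η)/12}` with positive exponent, since
different tableaux have `D ≥ 1`. -/
theorem quasiBound_lt {C' η δ : ℝ} (hC : 0 < C') (hδ : 0 < δ) (hη : η < 2 / 9) {ε : ℝ}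
    (hε : 0 < ε) :
    ∃ N : ℕ, ∀ (n : ℕ) (μ : YoungDiagram) (m l : Tableau d μ), N ≤ n → μ.card = n → m ≠ l →
      l.total ≤ m.total → (m.total : ℝ) ≤ (n : ℝ) ^ η →
      quasiBound C' 0 η δ n m.total l.total (m.diff l) < ε := by
  obtain ⟨A, hA, hbound⟩ := quasiBound_le (d := d) (η := η) hC hδ
  have hs : 0 < (2 - 9 * η) / 12 := by linarith
  have hlim : Filter.Tendsto (fun n : ℕ => A ^ 2 * (n : ℝ) ^ (-((2 - 9 * η) / 12)))
      Filter.atTop (nhds 0) := by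
    have := ((tendsto_rpow_neg_atTop hs).comp tendsto_natCast_atTop_atTop).const_mul (A ^ 2)
    simpa using this
  obtain ⟨N, hN⟩ := Filter.eventually_atTop.1
    (hlim.eventually (gt_mem_nhds (lt_min hε zero_lt_one)))
  refine ⟨N, fun n μ m l hNn hn hne hle hm => ?_⟩
  have hsmall := hN n hNn
  set x := A ^ 2 * (n : ℝ) ^ (-((2 - 9 * η) / 12)) with hx
  have hx0 : 0 ≤ x := by positivity
  have hD : 1 ≤ m.diff l :=
    Nat.one_le_iff_ne_zero.2 fun h => hne (Tableau.eq_of_diff_eq_zero h)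
  calc quasiBound C' 0 η δ n m.total l.total (m.diff l)
      ≤ A ^ (1 + m.diff l) * (n : ℝ) ^ ((9 * η - 2) * (m.diff l : ℝ) / 12) :=
        hbound n μ m l hn hle hm
    _ ≤ (A ^ 2) ^ m.diff l * (n : ℝ) ^ ((9 * η - 2) * (m.diff l : ℝ) / 12) := by
        rw [← pow_mul]
        gcongr ?_ * _
        exact pow_le_pow_right₀ hA (by omega)
    _ = x ^ m.diff l := by
        rw [hx, mul_pow, ← Real.rpow_mul_natCast (Nat.cast_nonneg n)]
        congr 2
        ring
    _ ≤ x := pow_le_of_le_one hx0 (hsmall.le.trans (min_le_right _ _)) (by omega)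
    _ < ε := hsmall.trans_le (min_le_left _ _)

end Bounds

end YoungBasis

open YoungBasis in
theorem lemma7p3 (d : ℕ) :
    -- different multiplicities: orthogonality
    (∀ (μ : YoungDiagram) (m l : Tableau d μ),
      (∃ i : Fin d, m.shift i ≠ l.shift i) → inner ℂ m.ket l.ket = 0) ∧
    -- equal multiplicities: quasi-orthogonality
    ∃ C K : ℝ, 0 < C ∧ 0 ≤ K ∧ ∀ η : ℝ, η < 1 / 3 → ∃ C' : ℝ, 0 < C' ∧ ∀ δ : ℝ, 0 < δ →
      (∀ (n : ℕ) (μ : YoungDiagram) (m l : Tableau d μ), μ.card = n →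
        (∀ i : Fin d, m.shift i = l.shift i) →
        (∀ i : ℕ, i + 1 < d → δ * n < (μ.rowLen i : ℝ) - μ.rowLen (i + 1)) →
        (∀ i : ℕ, i + 1 = d → δ * n < μ.rowLen i) →
        l.total ≤ m.total → (m.total : ℝ) ≤ (n : ℝ) ^ η →
        C * (n : ℝ) ^ (3 * η - 1) / δ ^ 2 < 1 →
        ‖inner ℂ m.ket l.ket‖ ≤ quasiBound C' K η δ n m.total l.total (m.diff l)) ∧
      -- order of the right-hand side
      (∃ A : ℝ, 0 < A ∧ ∀ (n : ℕ) (μ : YoungDiagram) (m l : Tableau d μ), μ.card = n →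
        l.total ≤ m.total → (m.total : ℝ) ≤ (n : ℝ) ^ η →
        quasiBound C' K η δ n m.total l.total (m.diff l) ≤
          A ^ (1 + m.diff l) * (n : ℝ) ^ ((9 * η - 2) * (m.diff l : ℝ) / 12)) ∧
      -- the right-hand side tends to zero, uniformly in the tableaux
      (η < 2 / 9 → ∀ ε : ℝ, 0 < ε → ∃ N : ℕ, ∀ (n : ℕ) (μ : YoungDiagram) (m l : Tableau d μ),
        N ≤ n → μ.card = n → m ≠ l →
        l.total ≤ m.total → (m.total : ℝ) ≤ (n : ℝ) ^ η →
        quasiBound C' K η δ n m.total l.total (m.diff l) < ε) := by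
  refine ⟨fun μ m l ⟨i, hi⟩ => inner_ket_eq_zero m l hi, ?_⟩
  -- the factor `1 + K n^{-1+3η} / δ ≥ 1` is not needed, so that `K = 0` gives the strongest bound
  refine ⟨overlapConst d ^ 36, 0, pow_pos (by linarith [two_le_overlapConst d]) _, le_rfl,
    fun η hη => ⟨boundConst d η, boundConst_pos d η, fun δ hδ => ⟨?_, ?_, ?_⟩⟩⟩
  · intro n μ m l hn hshift hgap _ hle hm hC
    exact norm_inner_ket_le_quasiBound hη hδ hn m l hshift hgap hle hm hC
  · obtain ⟨A, hA, h⟩ := quasiBound_le (d := d) (η := η) (boundConst_pos d η) hδ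
    exact ⟨A, zero_lt_one.trans_le hA, h⟩
  · exact fun hη' ε hε => quasiBound_lt (boundConst_pos d η) hδ hη' hε
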